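/- A unital Banach algebra is a unital $\mathbb C$-algebra $A$, complete for a norm with $\|ab\|\le\|a\|\,\|b\|$; a unital morphism $\theta:A\to B$ is a unital algebra morphism with $\|\theta(a)\|\le\|a\|$. $K_0(A)$ is the universal group of the monoid of isomorphism classes of finitely generated projective right $A$-modules, and $\theta_*:K_0(A)\to K_0(B)$ is induced by $P\mapsto P\otimes_A B$. A right Banach $A$-module is a complex Banach space $E$ with a unital right action of $A$ satisfying $\|xa\|\le\|x\|\,\|a\|$. Let $\mathcal L_A(E,F)$ be the space of continuous $A$-linear maps $E\to F$, and let $\mathcal K_A(E,F)$ (the $A$-compact morphisms) be the closed linear span, in operator norm, of the maps $w\circ v$ with $v\in\mathcal L_A(E,A)$, $w\in\mathcal L_A(A,F)$. A Fredholm module over $A$ is a $\mathbb Z/2$-graded right Banach $A$-module $E=E_0\oplus E_1$ with an odd $T=\begin{pmatrix}0&v\\u&0\end{pmatrix}\in\mathcal L_A(E)$ such that $T^2-\mathrm{Id}_E$ is $A$-compact, i.e. $vu-\mathrm{Id}_{E_0}\in\mathcal K_A(E_0)$ and $uv-\mathrm{Id}_{E_1}\in\mathcal K_A(E_1)$. An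 isomorphism of Fredholm modules is an even invertible continuous $A$-linear map, with continuous inverse, intertwining the operators $T$. For a unital morphism $\theta:A\to B$ put $\theta_*(E,T)=(E\otimes_A B,\,T\otimes 1)$, where $E\otimes_A B$ is the completion of the algebraic tensor product for the largest (semi)norm with $\|x\otimes b\|\le\|x\|\,\|b\|$. Two Fredholm modules over $A$ are homotopic if, up to isomorphism, they are the images under the evaluations at $0$ and $1$ of a Fredholm module over $A[0,1]$, the Banach algebra of continuous functions $[0,1]\to A$ with the supremum norm. **Theorem.** For every unital Banach algebra $A$, homotopy is an equivalence relation on Fredholm modules over $A$. Homotopy classes are functorial: for unital morphisms $\theta:A\to B$ and $\varphi:B\to C$, $\theta_*$ respects homotopy, $(\mathrm{Id}_A)_*F$ is homotopic to $F$, and $(\varphi\theta)_*F$ is homotopic to $\varphi_*\theta_*F$. There are bijections $$\mathrm{ind}_A:\{\text{Fredholm modules over }A\}/\text{homotopy}\longrightarrow K_0(A),$$ one for each unital Banach algebra $A$, such that: 1. for every Fredholm module $(E_0,E_1,u,v)$ over $A$ there are $n\in\mathbb N$ and $w\in\mathcal K_A(A^n,E_1)$ such that $(u,w):E_0\oplus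 A^n\to E_1$ is surjective, and for every such pair $(n,w)$ the right $A$-module $\ker(u,w)$ is finitely generated projective and $\mathrm{ind}_A[(E_0,E_1,u,v)]=[\ker(u,w)]-[A^n]$; 2. for every unital morphism $\theta:A\to B$ and every Fredholm module $F$ over $A$, $\mathrm{ind}_B[\theta_*F]=\theta_*(\mathrm{ind}_A[F])$. -/

import Mathlib

open scoped TensorProduct
open MulOpposite

universe u

set_option linter.unusedSectionVars false

namespace BanachKTheory

noncomputable section

/-! ### The algebraic tensor product `E ⊗_A B`

Right modules over `A` are modules over `Aᵐᵒᵖ`: the right action is `x a = op a • x`. For a ring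
homomorphism `θ : A → B`, the abelian group `E ⊗_A B` is the quotient of the tensor product over
`ℤ` by the relations `x a ⊗ b = x ⊗ θ(a) b`. The tensor factors are written in the opposite order,
as `B ⊗ E`, so that the right multiplication of `B` on itself gives the right `B`-module
structure. -/

section Algebraic

variable {A B : Type u} [Ring A] [Ring B] (θ : A →+* B)

/-- The relations `x ⊗ θ(a) b = x a ⊗ b`; they are stable under right multiplication by `B`. -/
def balancing (E : Type u) [AddCommGroup E] [Module Aᵐᵒᵖ E] : Submodule Bᵐᵒᵖ (B ⊗[ℤ] E) :=
  Submodule.span Bᵐᵒᵖ {z | ∃ (a : A) (b : B) (x : E), z = (θ a * b) ⊗ₜ[ℤ] x - b ⊗ₜ[ℤ] (op a • x)}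

/-- The algebraic tensor product `E ⊗_A B` as a right `B`-module. -/
abbrev BaseChange (E : Type u) [AddCommGroup E] [Module Aᵐᵒᵖ E] : Type u :=
  (B ⊗[ℤ] E) ⧸ balancing θ E

namespace BaseChange

variable {E F G : Type u} [AddCommGroup E] [Module Aᵐᵒᵖ E] [AddCommGroup F] [Module Aᵐᵒᵖ F]
  [AddCommGroup G] [Module Aᵐᵒᵖ G]

/-- The elementary tensor `x ⊗ b` in `E ⊗_A B`. -/
def tmul (x : E) (b : B) : BaseChange θ E := (balancing θ E).mkQ (b ⊗ₜ[ℤ] x)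

theorem tmul_balanced (x : E) (a : A) (b : B) : tmul θ (op a • x) b = tmul θ x (θ a * b) := by
  symm
  refine (Submodule.Quotient.eq _).2 (Submodule.subset_span ⟨a, b, x, rfl⟩)

theorem tmul_add_left (x y : E) (b : B) : tmul θ (x + y) b = tmul θ x b + tmul θ y b := by
  simp [tmul, TensorProduct.tmul_add]

theorem tmul_add_right (x : E) (b c : B) : tmul θ x (b + c) = tmul θ x b + tmul θ x c := by
  simp [tmul, TensorProduct.add_tmul]

theorem op_smul_tmul (c : B) (x : E) (b : B) : op c • tmul θ x b = tmul θ x (b * c) := rfl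

theorem tmul_zero_left (b : B) : tmul θ (0 : E) b = 0 := by
  simp [tmul]

theorem tmul_sum_left {ι : Type*} (s : Finset ι) (f : ι → E) (b : B) :
    tmul θ (∑ i ∈ s, f i) b = ∑ i ∈ s, tmul θ (f i) b := by
  simp [tmul, TensorProduct.tmul_sum]

theorem induction {p : BaseChange θ E → Prop} (h0 : p 0) (ht : ∀ x b, p (tmul θ x b))
    (ha : ∀ y z, p y → p z → p (y + z)) (z : BaseChange θ E) : p z := by
  obtain ⟨z, rfl⟩ := (balancing θ E).mkQ_surjective z
  induction z with
  | zero => simpa using h0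
  | tmul b x => exact ht x b
  | add y z hy hz => simpa using ha _ _ hy hz

theorem hom_ext {M : Type*} [AddCommGroup M] [Module Bᵐᵒᵖ M] {f g : BaseChange θ E →ₗ[Bᵐᵒᵖ] M}
    (h : ∀ x b, f (tmul θ x b) = g (tmul θ x b)) : f = g := by
  ext1
  ext
  exact h _ _

/-- The `B`-linear map `E ⊗_A B → M`, `x ⊗ b ↦ (f x) b`, given by an additive map `f : E → M` with
`f (x a) = f x θ(a)`. -/
def lift {M : Type u} [AddCommGroup M] [Module Bᵐᵒᵖ M] (f : E →+ M)
    (hf : ∀ a x, f (op a • x) = op (θ a) • f x) : BaseChange θ E →ₗ[Bᵐᵒᵖ] M :=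
  (balancing θ E).liftQ
    (TensorProduct.AlgebraTensorModule.lift
      { toFun := fun b =>
          { toFun := fun x => op b • f x
            map_add' := by intro x y; simp
            map_smul' := by intro n x; rw [map_zsmul, RingHom.id_apply, smul_comm] }
        map_add' := by intro b c; ext x; simp [add_smul]
        map_smul' := by intro c b; ext x; simp [mul_smul] })
    (by
      refine Submodule.span_le.2 ?_
      rintro _ ⟨a, b, x, rfl⟩
      simp [hf, mul_smul])

@[simp] theorem lift_tmul {M : Type u} [AddCommGroup M] [Module Bᵐᵒᵖ M] (f : E →+ M)
    (hf : ∀ a x, f (op a • x) = op (θ a) • f x) (x : E) (b : B) :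
    lift θ f hf (tmul θ x b) = op b • f x := rfl

/-- The map `f ⊗ 1 : E ⊗_A B → F ⊗_A B`, `x ⊗ b ↦ f(x) ⊗ b`. -/
def map (f : E →ₗ[Aᵐᵒᵖ] F) : BaseChange θ E →ₗ[Bᵐᵒᵖ] BaseChange θ F :=
  lift θ
    { toFun := fun x => tmul θ (f x) 1
      map_zero' := by simp [tmul_zero_left]
      map_add' := by intro x y; simp [tmul_add_left] }
    (by intro a x; simp [tmul_balanced, op_smul_tmul])

@[simp] theorem map_tmul (f : E →ₗ[Aᵐᵒᵖ] F) (x : E) (b : B) :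
    map θ f (tmul θ x b) = tmul θ (f x) b := by
  simp [map, op_smul_tmul]

theorem map_id : map θ (LinearMap.id : E →ₗ[Aᵐᵒᵖ] E) = LinearMap.id :=
  hom_ext θ (by simp)

theorem map_comp (g : F →ₗ[Aᵐᵒᵖ] G) (f : E →ₗ[Aᵐᵒᵖ] F) :
    map θ (g ∘ₗ f) = map θ g ∘ₗ map θ f :=
  hom_ext θ (by simp)

/-- `f ⊗ 1` for an isomorphism `f`. -/
def congr (f : E ≃ₗ[Aᵐᵒᵖ] F) : BaseChange θ E ≃ₗ[Bᵐᵒᵖ] BaseChange θ F :=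
  LinearEquiv.ofLinearMap (map θ f) (map θ f.symm)
    (by rw [← map_comp]; simp [map_id]) (by rw [← map_comp]; simp [map_id])

/-- `(E ⊕ F) ⊗_A B = (E ⊗_A B) ⊕ (F ⊗_A B)`. -/
def prodEquiv : BaseChange θ (E × F) ≃ₗ[Bᵐᵒᵖ] BaseChange θ E × BaseChange θ F :=
  LinearEquiv.ofLinearMap
    ((map θ (LinearMap.fst Aᵐᵒᵖ E F)).prod (map θ (LinearMap.snd Aᵐᵒᵖ E F)))
    ((map θ (LinearMap.inl Aᵐᵒᵖ E F)).coprod (map θ (LinearMap.inr Aᵐᵒᵖ E F)))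
    (by
      apply LinearMap.prod_ext
      · exact hom_ext θ (by simp [tmul_zero_left])
      · exact hom_ext θ (by simp [tmul_zero_left]))
    (hom_ext θ (by intro x b; simp [← tmul_add_left]))

/-- For the zero module. -/
theorem subsingleton [Subsingleton E] : Subsingleton (BaseChange θ E) := by
  refine ⟨fun y z => ?_⟩
  have h : ∀ z : BaseChange θ E, z = 0 := by
    intro z
    induction z using induction θ with
    | h0 => rfl
    | ht x b => rw [Subsingleton.elim x 0, tmul_zero_left]
    | ha y z hy hz => simp [hy, hz]
  rw [h y, h z]

section FiniteProjective

variable [Module.Finite Aᵐᵒᵖ E] [Module.Projective Aᵐᵒᵖ E]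

/-- If `E` is a direct summand of `A^n`, then `E ⊗_A B` is a direct summand of `B^n`. -/
theorem exists_retract : ∃ (n : ℕ) (i : BaseChange θ E →ₗ[Bᵐᵒᵖ] (Fin n → B))
    (p : (Fin n → B) →ₗ[Bᵐᵒᵖ] BaseChange θ E), p ∘ₗ i = LinearMap.id := by
  obtain ⟨n, p, hp⟩ := Module.Finite.exists_fin' Aᵐᵒᵖ E
  obtain ⟨i, hi⟩ := Module.projective_lifting_property p LinearMap.id hp
  refine ⟨n, lift θ
    { toFun := fun x j => θ (unop (i x j))
      map_zero' := by ext; simp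
      map_add' := by intro x y; ext; simp }
    (by intro a x; ext; simp),
    { toFun := fun c => ∑ j, tmul θ (p (Pi.single j 1)) (c j)
      map_add' := by intro c d; simp [tmul_add_right, Finset.sum_add_distrib]
      map_smul' := by
        intro r c
        induction r
        simp [Finset.smul_sum, op_smul_tmul] }, hom_ext θ ?_⟩
  intro x b
  have hx : ∑ j, op (unop (i x j)) • p (Pi.single j 1) = x := by
    have h1 : ∑ j, (i x j) • (Pi.single j 1 : Fin n → Aᵐᵒᵖ) = i x := by
      ext k
      simp [Finset.sum_apply, Pi.single_apply]
    calc _ = p (∑ j, (i x j) • (Pi.single j 1 : Fin n → Aᵐᵒᵖ)) := by simp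
      _ = x := by rw [h1]; exact LinearMap.congr_fun hi x
  calc _ = ∑ j, tmul θ (op (unop (i x j)) • p (Pi.single j 1)) b := by
        simp [tmul_balanced, -op_unop]
    _ = _ := by rw [← tmul_sum_left, hx]; rfl

instance : Module.Finite Bᵐᵒᵖ B :=
  Module.Finite.equiv (MulOpposite.opLinearEquiv Bᵐᵒᵖ : B ≃ₗ[Bᵐᵒᵖ] Bᵐᵒᵖ).symm

instance : Module.Free Bᵐᵒᵖ B :=
  Module.Free.of_equiv (MulOpposite.opLinearEquiv Bᵐᵒᵖ : B ≃ₗ[Bᵐᵒᵖ] Bᵐᵒᵖ).symm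

instance : Module.Finite Bᵐᵒᵖ (BaseChange θ E) := by
  obtain ⟨n, i, p, h⟩ := exists_retract θ (E := E)
  exact Module.Finite.of_surjective p fun z => ⟨i z, LinearMap.congr_fun h z⟩

instance : Module.Projective Bᵐᵒᵖ (BaseChange θ E) := by
  obtain ⟨n, i, p, h⟩ := exists_retract θ (E := E)
  exact Module.Projective.of_split i p h

end FiniteProjective

end BaseChange

end Algebraic

/-! ### The group `K_0` of a unital ring -/

section KZero

/-- A finitely generated projective right `A`-module. -/
structure FGProj (A : Type u) [Ring A] : Type (u + 1) where
  carrier : Type u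
  [addCommGroup : AddCommGroup carrier]
  [module : Module Aᵐᵒᵖ carrier]
  [finite : Module.Finite Aᵐᵒᵖ carrier]
  [projective : Module.Projective Aᵐᵒᵖ carrier]

attribute [instance] FGProj.addCommGroup FGProj.module FGProj.finite FGProj.projective

instance FGProj.setoid (A : Type u) [Ring A] : Setoid (FGProj A) where
  r P Q := Nonempty (P.carrier ≃ₗ[Aᵐᵒᵖ] Q.carrier)
  iseqv := ⟨fun _ => ⟨LinearEquiv.refl _ _⟩, fun ⟨e⟩ => ⟨e.symm⟩, fun ⟨e⟩ ⟨f⟩ => ⟨e.trans f⟩⟩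

/-- Isomorphism classes of finitely generated projective right `A`-modules. -/
def FGProjClass (A : Type u) [Ring A] : Type (u + 1) := Quotient (FGProj.setoid A)

instance (A : Type u) [Ring A] : Zero (FGProjClass A) := ⟨Quotient.mk _ ⟨PUnit.{u + 1}⟩⟩

instance (A : Type u) [Ring A] : Add (FGProjClass A) :=
  ⟨Quotient.map₂ (fun P Q => ⟨P.carrier × Q.carrier⟩)
    fun _ _ ⟨e⟩ _ _ ⟨f⟩ => ⟨LinearEquiv.prodCongr e f⟩⟩

/-- The direct sum makes the isomorphism classes a commutative monoid. -/
instance (A : Type u) [Ring A] : AddCommMonoid (FGProjClass A) where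
  add_assoc := by
    rintro ⟨P⟩ ⟨Q⟩ ⟨R⟩
    exact Quotient.sound ⟨LinearEquiv.prodAssoc _ _ _ _⟩
  zero_add := by
    rintro ⟨P⟩
    exact Quotient.sound ⟨LinearEquiv.uniqueProd⟩
  add_zero := by
    rintro ⟨P⟩
    exact Quotient.sound ⟨LinearEquiv.prodUnique⟩
  add_comm := by
    rintro ⟨P⟩ ⟨Q⟩
    exact Quotient.sound ⟨LinearEquiv.prodComm _ _ _⟩
  nsmul := nsmulRec

/-- `K_0(A)`: the universal group of the monoid of isomorphism classes of finitely generated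
projective right `A`-modules. -/
abbrev K0 (A : Type u) [Ring A] : Type (u + 1) := Algebra.GrothendieckAddGroup (FGProjClass A)

/-- The class `[P]` in `K_0(A)`. -/
def K0.cls (A : Type u) [Ring A] (P : Type u) [AddCommGroup P] [Module Aᵐᵒᵖ P]
    [Module.Finite Aᵐᵒᵖ P] [Module.Projective Aᵐᵒᵖ P] : K0 A :=
  Algebra.GrothendieckAddGroup.of (M := FGProjClass A) (Quotient.mk _ ⟨P⟩)

/-- `P ↦ P ⊗_A B` on isomorphism classes. -/
def FGProjClass.map {A B : Type u} [Ring A] [Ring B] (θ : A →+* B) :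
    FGProjClass A →+ FGProjClass B where
  toFun := Quotient.map (fun P => ⟨BaseChange θ P.carrier⟩) fun _ _ ⟨e⟩ => ⟨BaseChange.congr θ e⟩
  map_zero' := by
    have := BaseChange.subsingleton θ (E := PUnit.{u + 1})
    exact Quotient.sound ⟨0, 0, fun _ => Subsingleton.elim _ _, fun _ => Subsingleton.elim _ _⟩
  map_add' := by
    rintro ⟨P⟩ ⟨Q⟩
    exact Quotient.sound ⟨BaseChange.prodEquiv θ⟩

/-- `θ_* : K_0(A) → K_0(B)`, with `θ_* [P] = [P ⊗_A B]`. -/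
def K0.map {A B : Type u} [Ring A] [Ring B] (θ : A →+* B) : K0 A →+ K0 B :=
  Algebra.GrothendieckAddGroup.lift
    ((Algebra.GrothendieckAddGroup.of (M := FGProjClass B)).comp (FGProjClass.map θ))

theorem K0.map_cls {A B : Type u} [Ring A] [Ring B] (θ : A →+* B) (P : Type u) [AddCommGroup P]
    [Module Aᵐᵒᵖ P] [Module.Finite Aᵐᵒᵖ P] [Module.Projective Aᵐᵒᵖ P] :
    K0.map θ (K0.cls A P) = K0.cls B (BaseChange θ P) := by
  have key : ∀ {M G : Type (u + 1)} [AddCommMonoid M] [AddCommGroup G] (f : M →+ G) (m : M),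
      Algebra.GrothendieckAddGroup.lift f (Algebra.GrothendieckAddGroup.of m) = f m := by
    intro M G _ _ f m
    exact DFunLike.congr_fun (Algebra.GrothendieckAddGroup.lift.symm_apply_apply f) m
  exact key _ _

end KZero

/-! ### The completed tensor product `E ⊗_A B` -/

section Completed

variable {A B : Type u} [NormedRing A] [NormedRing B] [NormedAlgebra ℂ B] (θ : A →+* B)
  (E : Type u) [NormedAddCommGroup E] [Module Aᵐᵒᵖ E]

/-- The seminorms on `E ⊗_A B` with `‖x ⊗ b‖ ≤ ‖x‖ ‖b‖`. -/
def subcrossSeminorms : Set (Seminorm ℂ (BaseChange θ E)) :=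
  {q | ∀ x b, q (BaseChange.tmul θ x b) ≤ ‖x‖ * ‖b‖}

/-- The largest seminorm on `E ⊗_A B` with `‖x ⊗ b‖ ≤ ‖x‖ ‖b‖`. -/
def maxSeminorm : Seminorm ℂ (BaseChange θ E) := sSup (subcrossSeminorms θ E)

theorem bddAbove_subcrossSeminorms : BddAbove (subcrossSeminorms θ E) := by
  have h : ∀ z : BaseChange θ E, ∃ C : ℝ, ∀ q ∈ subcrossSeminorms θ E, q z ≤ C := by
    intro z
    induction z using BaseChange.induction θ with
    | h0 => exact ⟨0, fun q _ => by simp⟩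
    | ht x b => exact ⟨‖x‖ * ‖b‖, fun q hq => hq x b⟩
    | ha y z hy hz =>
      obtain ⟨C, hC⟩ := hy
      obtain ⟨D, hD⟩ := hz
      exact ⟨C + D, fun q hq => (map_add_le_add q y z).trans (add_le_add (hC q hq) (hD q hq))⟩
  choose g hg using h
  refine Seminorm.bddAbove_iff.2 ⟨g, ?_⟩
  rintro _ ⟨q, hq, rfl⟩ z
  exact hg z q hq

variable {E}

theorem le_maxSeminorm {q : Seminorm ℂ (BaseChange θ E)} (hq : q ∈ subcrossSeminorms θ E)
    (z : BaseChange θ E) : q z ≤ maxSeminorm θ E z :=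
  le_csSup (bddAbove_subcrossSeminorms θ E) hq z

theorem maxSeminorm_tmul_le (x : E) (b : B) :
    maxSeminorm θ E (BaseChange.tmul θ x b) ≤ ‖x‖ * ‖b‖ := by
  rw [maxSeminorm, Seminorm.sSup_apply (bddAbove_subcrossSeminorms θ E)]
  have : Nonempty (subcrossSeminorms θ E) :=
    ⟨⟨0, fun x b => by simpa using mul_nonneg (norm_nonneg x) (norm_nonneg b)⟩⟩
  exact ciSup_le fun q => q.2 x b

theorem le_mul_maxSeminorm (q : Seminorm ℂ (BaseChange θ E)) {C : ℝ} (hC : 0 ≤ C)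
    (hq : ∀ x b, q (BaseChange.tmul θ x b) ≤ C * (‖x‖ * ‖b‖)) (z : BaseChange θ E) :
    q z ≤ C * maxSeminorm θ E z := by
  rcases hC.eq_or_lt with rfl | hC
  · suffices h : q z = 0 by simp [h]
    induction z using BaseChange.induction θ with
    | h0 => simp
    | ht x b => exact le_antisymm (by simpa using hq x b) (apply_nonneg q _)
    | ha y z hy hz =>
      exact le_antisymm ((map_add_le_add q y z).trans (by simp [hy, hz])) (apply_nonneg q _)
  · let r : NNReal := ⟨C⁻¹, by positivity⟩
    have hmem : r • q ∈ subcrossSeminorms θ E := by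
      intro x b
      have : C⁻¹ * q (BaseChange.tmul θ x b) ≤ ‖x‖ * ‖b‖ := by
        rw [inv_mul_le_iff₀ hC]
        exact hq x b
      exact this
    have h : C⁻¹ * q z ≤ maxSeminorm θ E z := le_maxSeminorm θ hmem z
    rwa [inv_mul_le_iff₀ hC] at h

variable (E)

/-- `E ⊗_A B` with the largest seminorm such that `‖x ⊗ b‖ ≤ ‖x‖ ‖b‖`. -/
def PreTensor : Type u := BaseChange θ E

instance : AddCommGroup (PreTensor θ E) := inferInstanceAs (AddCommGroup (BaseChange θ E))

instance : Module Bᵐᵒᵖ (PreTensor θ E) := inferInstanceAs (Module Bᵐᵒᵖ (BaseChange θ E))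

instance : Module ℂ (PreTensor θ E) := inferInstanceAs (Module ℂ (BaseChange θ E))

instance : IsScalarTower ℂ Bᵐᵒᵖ (PreTensor θ E) :=
  inferInstanceAs (IsScalarTower ℂ Bᵐᵒᵖ (BaseChange θ E))

instance : SeminormedAddCommGroup (PreTensor θ E) :=
  AddGroupSeminorm.toSeminormedAddCommGroup (maxSeminorm θ E).toAddGroupSeminorm

theorem PreTensor.norm_def (z : PreTensor θ E) : ‖z‖ = maxSeminorm θ E z := rfl

instance : NormedSpace ℂ (PreTensor θ E) where
  norm_smul_le c z := (map_smul_eq_mul (maxSeminorm θ E) c z).le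

instance : IsBoundedSMul Bᵐᵒᵖ (PreTensor θ E) := by
  refine IsBoundedSMul.of_norm_smul_le fun r z => ?_
  refine le_mul_maxSeminorm θ
    ((maxSeminorm θ E).comp (Module.toModuleEnd ℂ (BaseChange θ E) r)) (norm_nonneg r) ?_ z
  intro x b
  obtain ⟨c, rfl⟩ := op_surjective r
  refine (maxSeminorm_tmul_le θ x (b * c)).trans ?_
  calc ‖x‖ * ‖b * c‖ ≤ ‖x‖ * (‖b‖ * ‖c‖) := by gcongr; exact norm_mul_le b c
    _ = ‖op c‖ * (‖x‖ * ‖b‖) := by rw [norm_op]; ring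

namespace PreTensor

variable {E}

/-- The elementary tensor `x ⊗ b`. -/
def tmul (x : E) (b : B) : PreTensor θ E := BaseChange.tmul θ x b

theorem norm_tmul_le (x : E) (b : B) : ‖tmul θ x b‖ ≤ ‖x‖ * ‖b‖ := maxSeminorm_tmul_le θ x b

theorem tmul_balanced (x : E) (a : A) (b : B) : tmul θ (op a • x) b = tmul θ x (θ a * b) :=
  BaseChange.tmul_balanced θ x a b

theorem tmul_add_left (x y : E) (b : B) : tmul θ (x + y) b = tmul θ x b + tmul θ y b :=
  BaseChange.tmul_add_left θ x y b

theorem tmul_add_right (x : E) (b c : B) : tmul θ x (b + c) = tmul θ x b + tmul θ x c :=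
  BaseChange.tmul_add_right θ x b c

theorem tmul_zero_left (b : B) : tmul θ (0 : E) b = 0 := BaseChange.tmul_zero_left θ b

theorem op_smul_tmul (c : B) (x : E) (b : B) : op c • tmul θ x b = tmul θ x (b * c) := rfl

theorem smul_tmul (c : ℂ) (x : E) (b : B) : c • tmul θ x b = tmul θ x (c • b) := rfl

theorem induction {p : PreTensor θ E → Prop} (h0 : p 0) (ht : ∀ x b, p (tmul θ x b))
    (ha : ∀ y z, p y → p z → p (y + z)) (z : PreTensor θ E) : p z :=
  BaseChange.induction θ h0 ht ha z

/-- The `B`-linear map `x ⊗ b ↦ (f x) b` on the algebraic tensor product. -/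
def lift {M : Type u} [AddCommGroup M] [Module Bᵐᵒᵖ M] (f : E →+ M)
    (hf : ∀ a x, f (op a • x) = op (θ a) • f x) : PreTensor θ E →ₗ[Bᵐᵒᵖ] M :=
  BaseChange.lift θ f hf

theorem lift_tmul {M : Type u} [AddCommGroup M] [Module Bᵐᵒᵖ M] (f : E →+ M)
    (hf : ∀ a x, f (op a • x) = op (θ a) • f x) (x : E) (b : B) :
    lift θ f hf (tmul θ x b) = op b • f x := rfl

/-- A `B`-linear map on `E ⊗_A B` that is bounded on elementary tensors is bounded. -/
theorem norm_apply_le {M : Type u} [SeminormedAddCommGroup M] [NormedSpace ℂ M]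
    [Module Bᵐᵒᵖ M] [IsScalarTower ℂ Bᵐᵒᵖ M] (f : PreTensor θ E →ₗ[Bᵐᵒᵖ] M) {C : ℝ}
    (hC : 0 ≤ C) (hf : ∀ x b, ‖f (tmul θ x b)‖ ≤ C * (‖x‖ * ‖b‖)) (z : PreTensor θ E) :
    ‖f z‖ ≤ C * ‖z‖ :=
  le_mul_maxSeminorm θ ((normSeminorm ℂ M).comp (f.restrictScalars ℂ)) hC hf z

/-- The continuous `B`-linear map `x ⊗ b ↦ (f x) b`, for a bounded `f`. -/
def liftCLM {M : Type u} [SeminormedAddCommGroup M] [NormedSpace ℂ M] [Module Bᵐᵒᵖ M]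
    [IsScalarTower ℂ Bᵐᵒᵖ M] (f : E →+ M) (hf : ∀ a x, f (op a • x) = op (θ a) • f x) (C : ℝ)
    (hC : 0 ≤ C) (hb : ∀ x (b : B), ‖op b • f x‖ ≤ C * (‖x‖ * ‖b‖)) :
    PreTensor θ E →L[Bᵐᵒᵖ] M where
  toLinearMap := lift θ f hf
  cont := AddMonoidHomClass.continuous_of_bound (lift θ f hf) C (norm_apply_le θ _ hC hb)

theorem liftCLM_tmul {M : Type u} [SeminormedAddCommGroup M] [NormedSpace ℂ M] [Module Bᵐᵒᵖ M]
    [IsScalarTower ℂ Bᵐᵒᵖ M] (f : E →+ M) (hf : ∀ a x, f (op a • x) = op (θ a) • f x) (C : ℝ)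
    (hC : 0 ≤ C) (hb : ∀ x (b : B), ‖op b • f x‖ ≤ C * (‖x‖ * ‖b‖)) (x : E) (b : B) :
    liftCLM θ f hf C hC hb (tmul θ x b) = op b • f x := rfl

end PreTensor

end Completed

/-! ### Banach modules and `A`-compact morphisms -/

section Compact

variable (A : Type u) [NormedRing A] [NormedAlgebra ℂ A]

/-- A right Banach `A`-module: a complex Banach space with a (unital, `ℂ`-compatible) right action
of `A` such that `‖x a‖ ≤ ‖x‖ ‖a‖`. -/
structure BanachModule : Type (u + 1) where
  carrier : Type u
  [normedAddCommGroup : NormedAddCommGroup carrier]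
  [normedSpace : NormedSpace ℂ carrier]
  [completeSpace : CompleteSpace carrier]
  [module : Module Aᵐᵒᵖ carrier]
  [isScalarTower : IsScalarTower ℂ Aᵐᵒᵖ carrier]
  [isBoundedSMul : IsBoundedSMul Aᵐᵒᵖ carrier]

attribute [instance] BanachModule.normedAddCommGroup BanachModule.normedSpace
  BanachModule.completeSpace BanachModule.module BanachModule.isScalarTower
  BanachModule.isBoundedSMul

instance : CoeSort (BanachModule A) (Type u) := ⟨BanachModule.carrier⟩

variable {A}
variable {E F G : Type u}
  [NormedAddCommGroup E] [NormedSpace ℂ E] [Module Aᵐᵒᵖ E] [IsScalarTower ℂ Aᵐᵒᵖ E]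
  [NormedAddCommGroup F] [NormedSpace ℂ F] [Module Aᵐᵒᵖ F] [IsScalarTower ℂ Aᵐᵒᵖ F]
  [NormedAddCommGroup G] [NormedSpace ℂ G] [Module Aᵐᵒᵖ G] [IsScalarTower ℂ Aᵐᵒᵖ G]

variable (A E F) in
/-- The `A`-rank one morphisms `E → F`: those that factor through the right `A`-module `A`. -/
def rankOne : Set (E →L[ℂ] F) :=
  {k | ∃ (v : E →L[Aᵐᵒᵖ] A) (w : A →L[Aᵐᵒᵖ] F), k = (w.comp v).restrictScalars ℂ}

variable (A E F) in
/-- The closed vector span of the `A`-rank one morphisms, for the operator norm. -/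
def compactMorphisms : Submodule ℂ (E →L[ℂ] F) :=
  (Submodule.span ℂ (rankOne A E F)).topologicalClosure

/-- A morphism of right Banach `A`-modules is `A`-compact if it lies in the closed vector span of
the `A`-rank one morphisms. -/
def IsACompact (f : E →L[Aᵐᵒᵖ] F) : Prop := f.restrictScalars ℂ ∈ compactMorphisms A E F

theorem IsACompact.comp_left {f : E →L[Aᵐᵒᵖ] F} (hf : IsACompact f) (g : F →L[Aᵐᵒᵖ] G) :
    IsACompact (g.comp f) := by
  have h : compactMorphisms A E F ≤
      (compactMorphisms A E G).comap
        (ContinuousLinearMap.compL ℂ E F G (g.restrictScalars ℂ)).toLinearMap := by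
    refine Submodule.topologicalClosure_minimal _ (Submodule.span_le.2 ?_)
      ((Submodule.isClosed_topologicalClosure _).preimage
        (ContinuousLinearMap.compL ℂ E F G (g.restrictScalars ℂ)).continuous)
    rintro _ ⟨v, w, rfl⟩
    exact Submodule.le_topologicalClosure _ (Submodule.subset_span ⟨v, g.comp w, rfl⟩)
  exact h hf

theorem IsACompact.comp_right {f : F →L[Aᵐᵒᵖ] G} (hf : IsACompact f) (g : E →L[Aᵐᵒᵖ] F) :
    IsACompact (f.comp g) := by
  have h : compactMorphisms A F G ≤ (compactMorphisms A E G).comap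
      ((ContinuousLinearMap.compL ℂ E F G).flip (g.restrictScalars ℂ)).toLinearMap := by
    refine Submodule.topologicalClosure_minimal _ (Submodule.span_le.2 ?_)
      ((Submodule.isClosed_topologicalClosure _).preimage
        ((ContinuousLinearMap.compL ℂ E F G).flip (g.restrictScalars ℂ)).continuous)
    rintro _ ⟨v, w, rfl⟩
    exact Submodule.le_topologicalClosure _ (Submodule.subset_span ⟨v.comp g, w, rfl⟩)
  exact h hf

theorem IsACompact.add {f g : E →L[Aᵐᵒᵖ] F} (hf : IsACompact f) (hg : IsACompact g) :
    IsACompact (f + g) :=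
  (compactMorphisms A E F).add_mem hf hg

end Compact

/-! ### Extension of scalars along a morphism of Banach algebras -/

section Extension

/-- A unital morphism of Banach algebras: an algebra morphism with `‖θ(a)‖ ≤ ‖a‖`. -/
structure BanachAlgHom (A B : Type u) [NormedRing A] [NormedAlgebra ℂ A] [NormedRing B]
    [NormedAlgebra ℂ B] extends A →ₐ[ℂ] B where
  norm_map_le : ∀ a : A, ‖toFun a‖ ≤ ‖a‖

/-- The underlying ring homomorphism. -/
def BanachAlgHom.ringHom {A B : Type u} [NormedRing A] [NormedAlgebra ℂ A] [NormedRing B]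
    [NormedAlgebra ℂ B] (θ : BanachAlgHom A B) : A →+* B := θ.toAlgHom.toRingHom

/-- The identity morphism. -/
def BanachAlgHom.id (A : Type u) [NormedRing A] [NormedAlgebra ℂ A] : BanachAlgHom A A where
  toAlgHom := AlgHom.id ℂ A
  norm_map_le _ := le_rfl

/-- The composition of morphisms. -/
def BanachAlgHom.comp {A B C : Type u} [NormedRing A] [NormedAlgebra ℂ A] [NormedRing B]
    [NormedAlgebra ℂ B] [NormedRing C] [NormedAlgebra ℂ C] (φ : BanachAlgHom B C)
    (θ : BanachAlgHom A B) : BanachAlgHom A C where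
  toAlgHom := φ.toAlgHom.comp θ.toAlgHom
  norm_map_le a := (φ.norm_map_le _).trans (θ.norm_map_le a)

variable {A B : Type u} [NormedRing A] [NormedAlgebra ℂ A] [NormedRing B] [NormedAlgebra ℂ B]

section Maps

variable (θ : BanachAlgHom A B)

/-- The completion of `E ⊗_A B` for the largest norm such that `‖x ⊗ b‖ ≤ ‖x‖ ‖b‖`. -/
abbrev CompletedTensor (E : Type u) [NormedAddCommGroup E] [Module Aᵐᵒᵖ E] : Type u :=
  UniformSpace.Completion (PreTensor θ.ringHom E)

instance (E : Type u) [NormedAddCommGroup E] [Module Aᵐᵒᵖ E] :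
    IsScalarTower ℂ Bᵐᵒᵖ (CompletedTensor θ E) := inferInstance

variable {E F G : Type u}
  [NormedAddCommGroup E] [NormedSpace ℂ E] [Module Aᵐᵒᵖ E] [IsScalarTower ℂ Aᵐᵒᵖ E]
  [NormedAddCommGroup F] [NormedSpace ℂ F] [Module Aᵐᵒᵖ F] [IsScalarTower ℂ Aᵐᵒᵖ F]
  [NormedAddCommGroup G] [NormedSpace ℂ G] [Module Aᵐᵒᵖ G] [IsScalarTower ℂ Aᵐᵒᵖ G]

/-- The class of `x ⊗ b` in the completed tensor product. -/
def ctmul (x : E) (b : B) : CompletedTensor θ E :=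
  ((PreTensor.tmul θ.ringHom x b : PreTensor θ.ringHom E) : CompletedTensor θ E)

theorem norm_ctmul_le (x : E) (b : B) : ‖ctmul θ x b‖ ≤ ‖x‖ * ‖b‖ := by
  rw [ctmul, UniformSpace.Completion.norm_coe]
  exact PreTensor.norm_tmul_le _ x b

theorem ctmul_balanced (x : E) (a : A) (b : B) :
    ctmul θ (op a • x) b = ctmul θ x (θ.ringHom a * b) := by
  rw [ctmul, PreTensor.tmul_balanced, ctmul]

theorem ctmul_add_left (x y : E) (b : B) : ctmul θ (x + y) b = ctmul θ x b + ctmul θ y b := by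
  rw [ctmul, PreTensor.tmul_add_left, UniformSpace.Completion.coe_add, ctmul, ctmul]

theorem ctmul_add_right (x : E) (b c : B) : ctmul θ x (b + c) = ctmul θ x b + ctmul θ x c := by
  rw [ctmul, PreTensor.tmul_add_right, UniformSpace.Completion.coe_add, ctmul, ctmul]

theorem op_smul_ctmul (c : B) (x : E) (b : B) : op c • ctmul θ x b = ctmul θ x (b * c) := by
  rw [ctmul, ctmul, ← PreTensor.op_smul_tmul, UniformSpace.Completion.coe_smul]

theorem ctmul_smul_left (c : ℂ) (x : E) (b : B) : ctmul θ (c • x) b = c • ctmul θ x b := by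
  have h1 : c • x = op (c • (1 : A)) • x := by rw [op_smul, op_one, smul_assoc, one_smul]
  have h2 : θ.ringHom (c • (1 : A)) * b = c • b := by
    have h3 : θ.ringHom (c • (1 : A)) = c • (1 : B) := by
      have := map_smul θ.toAlgHom c 1
      rwa [map_one] at this
    rw [h3, smul_mul_assoc, one_mul]
  rw [h1, ctmul_balanced, h2, ctmul, ctmul, ← UniformSpace.Completion.coe_smul,
    PreTensor.smul_tmul]

theorem norm_le_of_morphism (f : E →L[Aᵐᵒᵖ] F) (x : E) :
    ‖f x‖ ≤ ‖f.restrictScalars ℂ‖ * ‖x‖ := (f.restrictScalars ℂ).le_opNorm x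

/-- `f ⊗ 1` on the algebraic tensor products. -/
def preMap (f : E →L[Aᵐᵒᵖ] F) : PreTensor θ.ringHom E →L[Bᵐᵒᵖ] PreTensor θ.ringHom F :=
  PreTensor.liftCLM θ.ringHom
    { toFun := fun x => PreTensor.tmul θ.ringHom (f x) 1
      map_zero' := by rw [map_zero, PreTensor.tmul_zero_left]
      map_add' := by intro x y; rw [map_add, PreTensor.tmul_add_left] }
    (by
      intro a x
      simp [PreTensor.tmul_balanced, PreTensor.op_smul_tmul])
    ‖f.restrictScalars ℂ‖ (norm_nonneg _) (by
      intro x b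
      simp only [AddMonoidHom.coe_mk, ZeroHom.coe_mk, PreTensor.op_smul_tmul, one_mul]
      refine (PreTensor.norm_tmul_le θ.ringHom (f x) b).trans ?_
      rw [← mul_assoc]
      gcongr
      exact norm_le_of_morphism f x)

theorem preMap_tmul (f : E →L[Aᵐᵒᵖ] F) (x : E) (b : B) :
    preMap θ f (PreTensor.tmul θ.ringHom x b) = PreTensor.tmul θ.ringHom (f x) b := by
  rw [preMap, PreTensor.liftCLM_tmul]
  simp [PreTensor.op_smul_tmul]

/-- `f ⊗ 1` on the completed tensor products. -/
def cmap (f : E →L[Aᵐᵒᵖ] F) : CompletedTensor θ E →L[Bᵐᵒᵖ] CompletedTensor θ F :=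
  (preMap θ f).completion

theorem cmap_ctmul (f : E →L[Aᵐᵒᵖ] F) (x : E) (b : B) :
    cmap θ f (ctmul θ x b) = ctmul θ (f x) b := by
  rw [cmap, ctmul, ContinuousLinearMap.completion_apply_coe, preMap_tmul, ctmul]

/-- Continuous `B`-linear maps on `E ⊗_A B` are determined by the elementary tensors. -/
theorem CompletedTensor.hom_ext {M : Type u} [NormedAddCommGroup M] [Module Bᵐᵒᵖ M]
    {f g : CompletedTensor θ E →L[Bᵐᵒᵖ] M} (h : ∀ x b, f (ctmul θ x b) = g (ctmul θ x b)) :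
    f = g := by
  ext z
  induction z using UniformSpace.Completion.induction_on with
  | hp => exact isClosed_eq f.continuous g.continuous
  | ih z =>
    induction z using PreTensor.induction θ.ringHom with
    | h0 => rw [UniformSpace.Completion.coe_zero, map_zero, map_zero]
    | ht x b => exact h x b
    | ha y z hy hz => rw [UniformSpace.Completion.coe_add, map_add, map_add, hy, hz]

theorem cmap_id : cmap θ (ContinuousLinearMap.id Aᵐᵒᵖ E) = ContinuousLinearMap.id Bᵐᵒᵖ _ :=
  CompletedTensor.hom_ext θ (by simp [cmap_ctmul])

theorem cmap_comp (g : F →L[Aᵐᵒᵖ] G) (f : E →L[Aᵐᵒᵖ] F) :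
    cmap θ (g.comp f) = (cmap θ g).comp (cmap θ f) :=
  CompletedTensor.hom_ext θ (by simp [cmap_ctmul])

theorem cmap_add (f g : E →L[Aᵐᵒᵖ] F) : cmap θ (f + g) = cmap θ f + cmap θ g :=
  CompletedTensor.hom_ext θ (by simp [cmap_ctmul, ctmul_add_left])

theorem cmap_sub (f g : E →L[Aᵐᵒᵖ] F) : cmap θ (f - g) = cmap θ f - cmap θ g := by
  rw [eq_sub_iff_add_eq, ← cmap_add, sub_add_cancel]

theorem norm_cmap_le (f : E →L[Aᵐᵒᵖ] F) :
    ‖(cmap θ f).restrictScalars ℂ‖ ≤ ‖f.restrictScalars ℂ‖ := by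
  refine ContinuousLinearMap.opNorm_le_bound _ (norm_nonneg _) fun z => ?_
  change ‖cmap θ f z‖ ≤ _
  induction z using UniformSpace.Completion.induction_on with
  | hp => exact isClosed_le (cmap θ f).continuous.norm (continuous_const.mul continuous_norm)
  | ih z =>
    rw [cmap, ContinuousLinearMap.completion_apply_coe, UniformSpace.Completion.norm_coe,
      UniformSpace.Completion.norm_coe]
    refine PreTensor.norm_apply_le θ.ringHom (preMap θ f).toLinearMap (norm_nonneg _) ?_ z
    intro x b
    refine (congrArg norm (preMap_tmul θ f x b)).le.trans ?_
    refine (PreTensor.norm_tmul_le θ.ringHom (f x) b).trans ?_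
    rw [← mul_assoc]
    gcongr
    exact norm_le_of_morphism f x

/-- `b ↦ x ⊗ b`. -/
def cvector (x : E) : B →L[Bᵐᵒᵖ] CompletedTensor θ E where
  toFun b := ctmul θ x b
  map_add' b c := ctmul_add_right θ x b c
  map_smul' r b := by
    obtain ⟨c, rfl⟩ := op_surjective r
    exact (op_smul_ctmul θ c x b).symm
  cont := AddMonoidHomClass.continuous_of_bound
    (AddMonoidHom.mk' (fun b => ctmul θ x b) (ctmul_add_right θ x)) ‖x‖ (norm_ctmul_le θ x)

variable [CompleteSpace B]

/-- `v ⊗ 1 : E ⊗_A B → A ⊗_A B = B`. -/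
def cfunctional (v : E →L[Aᵐᵒᵖ] A) : CompletedTensor θ E →L[Bᵐᵒᵖ] B :=
  (PreTensor.liftCLM θ.ringHom
    { toFun := fun x => θ.ringHom (v x)
      map_zero' := by simp
      map_add' := by intro x y; simp }
    (by intro a x; simp) ‖v.restrictScalars ℂ‖ (norm_nonneg _) (by
        intro x b
        calc ‖θ.ringHom (v x) * b‖ ≤ ‖θ.ringHom (v x)‖ * ‖b‖ := norm_mul_le _ _
          _ ≤ (‖v.restrictScalars ℂ‖ * ‖x‖) * ‖b‖ := by
              gcongr
              exact (θ.norm_map_le (v x)).trans (norm_le_of_morphism v x)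
          _ = _ := by ring)).fromCompletion

theorem cfunctional_ctmul (v : E →L[Aᵐᵒᵖ] A) (x : E) (b : B) :
    cfunctional θ v (ctmul θ x b) = θ.ringHom (v x) * b := by
  rw [cfunctional, ctmul, ContinuousLinearMap.fromCompletion_apply_coe]
  rfl

theorem cmap_rankOne (v : E →L[Aᵐᵒᵖ] A) (w : A →L[Aᵐᵒᵖ] F) :
    cmap θ (w.comp v) = (cvector θ (w 1)).comp (cfunctional θ v) := by
  refine CompletedTensor.hom_ext θ fun x b => ?_
  have h : w (v x) = op (v x) • w 1 := by rw [← map_smul]; simp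
  rw [cmap_ctmul, ContinuousLinearMap.comp_apply, ContinuousLinearMap.comp_apply,
    cfunctional_ctmul, h, ctmul_balanced]
  rfl

theorem IsACompact.cmap {f : E →L[Aᵐᵒᵖ] F} (hf : IsACompact f) : IsACompact (cmap θ f) := by
  have hspan : ∀ g ∈ Submodule.span ℂ (rankOne A E F), ∃ g' : E →L[Aᵐᵒᵖ] F,
      g = g'.restrictScalars ℂ ∧ (BanachKTheory.cmap θ g').restrictScalars ℂ ∈
        Submodule.span ℂ (rankOne B (CompletedTensor θ E) (CompletedTensor θ F)) := by
    intro g hg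
    induction hg using Submodule.span_induction with
    | mem g hg =>
      obtain ⟨v, w, rfl⟩ := hg
      exact ⟨w.comp v, rfl, Submodule.subset_span ⟨_, _, by rw [cmap_rankOne]⟩⟩
    | zero =>
      have h0 : BanachKTheory.cmap θ (0 : E →L[Aᵐᵒᵖ] F) = 0 := by
        rw [← sub_self (0 : E →L[Aᵐᵒᵖ] F), cmap_sub, sub_self]
      exact ⟨0, rfl, by rw [h0]; exact Submodule.zero_mem _⟩
    | add g h _ _ hg hh =>
      obtain ⟨g, rfl, hg⟩ := hg
      obtain ⟨h, rfl, hh⟩ := hh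
      refine ⟨g + h, rfl, ?_⟩
      rw [cmap_add]
      exact Submodule.add_mem _ hg hh
    | smul c g _ hg =>
      obtain ⟨g, rfl, hg⟩ := hg
      have := IsScalarTower.to_smulCommClass' (R := ℂ) (A := Aᵐᵒᵖ) (M := F)
      have := IsScalarTower.to_smulCommClass' (R := ℂ) (A := Bᵐᵒᵖ) (M := CompletedTensor θ F)
      refine ⟨c • g, rfl, ?_⟩
      have hc : BanachKTheory.cmap θ (c • g) = c • BanachKTheory.cmap θ g :=
        CompletedTensor.hom_ext θ (by simp [cmap_ctmul, ctmul_smul_left])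
      rw [hc]
      exact Submodule.smul_mem _ c hg
  refine Metric.mem_closure_iff.2 fun ε hε => ?_
  obtain ⟨g, hg, hfg⟩ := Metric.mem_closure_iff.1 hf ε hε
  obtain ⟨g, rfl, hg'⟩ := hspan g hg
  refine ⟨_, hg', lt_of_le_of_lt ?_ hfg⟩
  rw [dist_eq_norm, dist_eq_norm]
  have := norm_cmap_le θ (f - g)
  rw [cmap_sub] at this
  exact this

end Maps

end Extension

/-! ### Fredholm modules, homotopies, and the data that define the index -/

section Fredholm

/-- A Fredholm module over `A`: a `ℤ/2`-graded right Banach `A`-module `E = E₀ ⊕ E₁` with an odd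
morphism `T = (0 v; u 0)` such that `T² - 1` is `A`-compact, that is, `v u - 1` is `A`-compact on
`E₀` and `u v - 1` is `A`-compact on `E₁` (see `isACompact_sq_sub_id_iff`). -/
structure FredholmModule (A : Type u) [NormedRing A] [NormedAlgebra ℂ A] : Type (u + 1) where
  E₀ : BanachModule A
  E₁ : BanachModule A
  u : E₀ →L[Aᵐᵒᵖ] E₁
  v : E₁ →L[Aᵐᵒᵖ] E₀
  compact₀ : IsACompact (v.comp u - ContinuousLinearMap.id Aᵐᵒᵖ E₀)
  compact₁ : IsACompact (u.comp v - ContinuousLinearMap.id Aᵐᵒᵖ E₁)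

namespace FredholmModule

variable {A B : Type u} [NormedRing A] [NormedAlgebra ℂ A] [NormedRing B] [NormedAlgebra ℂ B]

/-- The odd morphism `T (x, y) = (v y, u x)` of `E₀ ⊕ E₁`. -/
def oddMorphism {E₀ E₁ : BanachModule A} (u : E₀ →L[Aᵐᵒᵖ] E₁) (v : E₁ →L[Aᵐᵒᵖ] E₀) :
    (E₀ × E₁) →L[Aᵐᵒᵖ] (E₀ × E₁) :=
  (v.comp (ContinuousLinearMap.snd Aᵐᵒᵖ E₀ E₁)).prod (u.comp (ContinuousLinearMap.fst Aᵐᵒᵖ E₀ E₁))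

/-- `T² - 1` is `A`-compact if and only if `v u - 1` and `u v - 1` are. -/
theorem isACompact_sq_sub_id_iff {E₀ E₁ : BanachModule A} (u : E₀ →L[Aᵐᵒᵖ] E₁)
    (v : E₁ →L[Aᵐᵒᵖ] E₀) :
    IsACompact ((oddMorphism u v).comp (oddMorphism u v) -
        ContinuousLinearMap.id Aᵐᵒᵖ (E₀ × E₁)) ↔
      IsACompact (v.comp u - ContinuousLinearMap.id Aᵐᵒᵖ E₀) ∧
        IsACompact (u.comp v - ContinuousLinearMap.id Aᵐᵒᵖ E₁) := by
  constructor
  · intro h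
    refine ⟨?_, ?_⟩
    · convert! (h.comp_right (ContinuousLinearMap.inl Aᵐᵒᵖ E₀ E₁)).comp_left
        (ContinuousLinearMap.fst Aᵐᵒᵖ E₀ E₁) using 1
    · convert! (h.comp_right (ContinuousLinearMap.inr Aᵐᵒᵖ E₀ E₁)).comp_left
        (ContinuousLinearMap.snd Aᵐᵒᵖ E₀ E₁) using 1
  · rintro ⟨h₀, h₁⟩
    convert! ((h₀.comp_right (ContinuousLinearMap.fst Aᵐᵒᵖ E₀ E₁)).comp_left
      (ContinuousLinearMap.inl Aᵐᵒᵖ E₀ E₁)).add ((h₁.comp_right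
      (ContinuousLinearMap.snd Aᵐᵒᵖ E₀ E₁)).comp_left (ContinuousLinearMap.inr Aᵐᵒᵖ E₀ E₁)) using 1
    ext x <;> simp [oddMorphism]

/-- An isomorphism of Fredholm modules: an even isomorphism of right Banach modules that
intertwines the odd morphisms. -/
def Iso (F G : FredholmModule A) : Prop :=
  ∃ (e₀ : F.E₀ ≃L[Aᵐᵒᵖ] G.E₀) (e₁ : F.E₁ ≃L[Aᵐᵒᵖ] G.E₁),
    (∀ x, e₁ (F.u x) = G.u (e₀ x)) ∧ ∀ y, e₀ (F.v y) = G.v (e₁ y)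

/-- The image `(E ⊗_A B, T ⊗ 1)` of a Fredholm module under a morphism `θ : A → B`. -/
def baseChange [CompleteSpace B] (θ : BanachAlgHom A B) (F : FredholmModule A) :
    FredholmModule B where
  E₀ := ⟨CompletedTensor θ F.E₀⟩
  E₁ := ⟨CompletedTensor θ F.E₁⟩
  u := cmap θ F.u
  v := cmap θ F.v
  compact₀ := by
    have h := F.compact₀.cmap θ
    rwa [cmap_sub, cmap_comp, cmap_id] at h
  compact₁ := by
    have h := F.compact₁.cmap θ
    rwa [cmap_sub, cmap_comp, cmap_id] at h

/-- The evaluation `A[0,1] → A` at `t`, where `A[0,1]` is the Banach algebra of continuous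
functions from `[0,1]` to `A` with the supremum norm. -/
def evalHom (A : Type u) [NormedRing A] [NormedAlgebra ℂ A] (t : unitInterval) :
    BanachAlgHom C(unitInterval, A) A where
  toFun f := f t
  map_one' := rfl
  map_mul' _ _ := rfl
  map_zero' := rfl
  map_add' _ _ := rfl
  commutes' _ := rfl
  norm_map_le f := f.norm_coe_le_norm t

/-- Two Fredholm modules over `A` are homotopic if they are (up to isomorphism) the images of a
Fredholm module over `A[0,1]` under the evaluations at `0` and `1`. -/
def Homotopic [CompleteSpace A] (F G : FredholmModule A) : Prop :=
  ∃ H : FredholmModule C(unitInterval, A),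
    Iso (H.baseChange (evalHom A 0)) F ∧ Iso (H.baseChange (evalHom A 1)) G

/-- The data `(n, w)` with `w ∈ K_A(A^n, E₁)` such that `(u, w) : E₀ ⊕ A^n → E₁` is surjective. -/
structure Stabilization (F : FredholmModule A) where
  n : ℕ
  w : (Fin n → A) →L[Aᵐᵒᵖ] F.E₁
  isACompact : IsACompact w
  surjective : Function.Surjective (F.u.coprod w)

/-- The kernel of `(u, w) : E₀ ⊕ A^n → E₁`. -/
abbrev Stabilization.kernel {F : FredholmModule A} (s : Stabilization F) :
    Submodule Aᵐᵒᵖ (F.E₀ × (Fin s.n → A)) :=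
  LinearMap.ker (F.u.coprod s.w).toLinearMap

end FredholmModule

/-- Homotopy classes of Fredholm modules over `A`. -/
def FredholmClass (A : Type u) [NormedRing A] [NormedAlgebra ℂ A] [CompleteSpace A] :
    Type (u + 1) :=
  Quot (FredholmModule.Homotopic (A := A))

/-- The homotopy class of a Fredholm module. -/
def FredholmClass.mk {A : Type u} [NormedRing A] [NormedAlgebra ℂ A] [CompleteSpace A]
    (F : FredholmModule A) : FredholmClass A := Quot.mk _ F

end Fredholm

end

end BanachKTheory

/-! An `A`-compact morphism is, up to an arbitrarily small error in norm, a morphism that factors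
through some `A^m`. Since `1 - uv` is compact, `uv + WV` is invertible for some `V`, `W` through
`A^m`, so `(u, W)` is onto. Any surjective `(u, w)` then has a continuous right inverse, because `W`
lifts through it (`exists_rightInverse`). The identity of `ker (u, w)` is compact, and a Banach
module with compact identity is a direct summand of some `A^m`: it is finitely generated projective
and every linear map out of it is continuous. Schanuel's argument makes `[ker (u, w)] - [A^n]`
independent of `(n, w)`; this is `FredholmModule.index`.

A split surjection stays split after tensoring, and the tensor product of a summand of `A^m` needs
no completion, so the index commutes with `θ_*` (`index_baseChange`). Homotopy invariance thus
reduces to the fact that all evaluations induce the same map `K_0(A[0,1]) → K_0(A)`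
(`K0.map_evalHom_eq`): a projective module over `A[0,1]` is a continuous path of idempotent
matrices, and nearby idempotents are similar.

For the converse, the splitting `E₀ ⊕ A^n = ker (u, w) ⊕ E₁` shows that `F ⊕ (A^n, A^n, 1, 1)` is,
up to compact morphisms, `(ker (u, w), A^n, 0, 0) ⊕ (E₁, E₁, 1, 1)`. If two indices agree, these
small modules are stably isomorphic, so `F ⊕ (X, X, 1, 1)` and `G ⊕ (Y, Y, 1, 1)` coincide up to
isomorphism and compact perturbation (`stablyEquiv_of_index_eq`). A single homotopy then joins `F`
to `G` (`Corner.homotopic`): the paths in the common module that start in the summand `F` and end in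
the summand `G`, with the linear path of operators. Its fibres at the ends are exactly `F` and `G`,
so the degenerate summands disappear without any concatenation of homotopies.

Hence homotopy is equality of indices (`homotopic_iff`). The equivalence relation and functoriality
follow from this, and surjectivity comes from the modules `(P, Q, 0, 0)`. -/

namespace BanachKTheory

noncomputable section

/-! ### Finite rank approximation and Banach modules with `A`-compact identity -/

section FiniteRank

variable {A : Type u} [NormedRing A] [NormedAlgebra ℂ A]
variable {E F G : Type u}
  [NormedAddCommGroup E] [NormedSpace ℂ E] [Module Aᵐᵒᵖ E] [IsScalarTower ℂ Aᵐᵒᵖ E]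
  [NormedAddCommGroup F] [NormedSpace ℂ F] [Module Aᵐᵒᵖ F] [IsScalarTower ℂ Aᵐᵒᵖ F]
  [NormedAddCommGroup G] [NormedSpace ℂ G] [Module Aᵐᵒᵖ G] [IsScalarTower ℂ Aᵐᵒᵖ G]

theorem IsACompact.neg {f : E →L[Aᵐᵒᵖ] F} (hf : IsACompact f) : IsACompact (-f) :=
  (compactMorphisms A E F).neg_mem hf

theorem IsACompact.sub {f g : E →L[Aᵐᵒᵖ] F} (hf : IsACompact f) (hg : IsACompact g) :
    IsACompact (f - g) :=
  (compactMorphisms A E F).sub_mem hf hg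

theorem isACompact_zero : IsACompact (0 : E →L[Aᵐᵒᵖ] F) :=
  (compactMorphisms A E F).zero_mem

theorem isACompact_comp (v : E →L[Aᵐᵒᵖ] A) (w : A →L[Aᵐᵒᵖ] F) : IsACompact (w.comp v) :=
  Submodule.le_topologicalClosure _ (Submodule.subset_span ⟨v, w, rfl⟩)

theorem isACompact_sum {ι : Type*} (s : Finset ι) (f : ι → E →L[Aᵐᵒᵖ] F)
    (hf : ∀ i ∈ s, IsACompact (f i)) : IsACompact (∑ i ∈ s, f i) := by
  classical
  induction s using Finset.induction_on with
  | empty => simpa using isACompact_zero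
  | insert i s hi ih =>
    rw [Finset.sum_insert hi]
    exact (hf i (by simp)).add (ih fun j hj => hf j (by simp [hj]))

theorem isACompact_id_fin (n : ℕ) : IsACompact (ContinuousLinearMap.id Aᵐᵒᵖ (Fin n → A)) := by
  have h : ContinuousLinearMap.id Aᵐᵒᵖ (Fin n → A) =
      ∑ i, (ContinuousLinearMap.single Aᵐᵒᵖ (fun _ : Fin n => A) i).comp
        (ContinuousLinearMap.proj i) := by
    ext x j
    simp [Finset.sum_apply, Pi.single_apply]
  rw [h]
  exact isACompact_sum _ _ fun i _ => isACompact_comp _ _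

theorem isACompact_of_fin {n : ℕ} (f : (Fin n → A) →L[Aᵐᵒᵖ] F) : IsACompact f := by
  simpa using (isACompact_id_fin n).comp_left f

/-- An `A`-compact morphism is a limit of morphisms that factor through some `A^m`. -/
theorem IsACompact.exists_factor {f : E →L[Aᵐᵒᵖ] F} (hf : IsACompact f) {ε : ℝ} (hε : 0 < ε) :
    ∃ (m : ℕ) (V : E →L[Aᵐᵒᵖ] (Fin m → A)) (W : (Fin m → A) →L[Aᵐᵒᵖ] F),
      ‖(f - W.comp V).restrictScalars ℂ‖ < ε := by
  obtain ⟨g, hg, hfg⟩ := Metric.mem_closure_iff.1 hf ε hε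
  obtain ⟨m, c, k, rfl⟩ := Submodule.mem_span_set'.1 hg
  choose v w hk using fun i => (k i).2
  have := IsScalarTower.to_smulCommClass' (R := ℂ) (A := Aᵐᵒᵖ) (M := F)
  refine ⟨m, ContinuousLinearMap.pi v,
    ∑ i, (c i • w i).comp (ContinuousLinearMap.proj i), ?_⟩
  convert hfg using 1
  rw [dist_eq_norm]
  congr 1
  ext x
  simp [hk]

/-- A morphism close to the identity is an isomorphism. -/
theorem exists_equiv_of_norm_lt_one [CompleteSpace E] (k : E →L[Aᵐᵒᵖ] E)
    (hk : ‖k.restrictScalars ℂ‖ < 1) :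
    ∃ e : E ≃L[Aᵐᵒᵖ] E, ∀ x, e x = x - k x := by
  let U := Units.oneSub (k.restrictScalars ℂ) hk
  have h1 : ∀ x, U.val x = x - k x := fun x => rfl
  have h2 : ∀ x, U.inv (U.val x) = x := fun x => DFunLike.congr_fun U.inv_mul x
  have h3 : ∀ x, U.val (U.inv x) = x := fun x => DFunLike.congr_fun U.mul_inv x
  -- The Neumann series inverts `1 - k` only among `ℂ`-linear operators; the inverse is `A`-linear
  -- because `1 - k` is.
  let g : E →L[Aᵐᵒᵖ] E :=
    { toFun := U.inv
      map_add' := map_add _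
      map_smul' := by
        intro a x
        have : a • x = U.val (a • U.inv x) := by
          rw [h1, map_smul, ← smul_sub, ← h1, h3]
        rw [this, h2]
        rfl
      cont := U.inv.continuous }
  exact ⟨ContinuousLinearEquiv.equivOfInverse (ContinuousLinearMap.id Aᵐᵒᵖ E - k) g h2 h3,
    fun x => rfl⟩

/-- If the identity is `A`-compact, then the module is a direct summand of some `A^m`. -/
theorem exists_retract_of_isACompact_id [CompleteSpace E]
    (h : IsACompact (ContinuousLinearMap.id Aᵐᵒᵖ E)) :
    ∃ (m : ℕ) (V : E →L[Aᵐᵒᵖ] (Fin m → A)) (W : (Fin m → A) →L[Aᵐᵒᵖ] E),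
      W.comp V = ContinuousLinearMap.id Aᵐᵒᵖ E := by
  obtain ⟨m, V, W, hVW⟩ := h.exists_factor one_pos
  obtain ⟨e, he⟩ := exists_equiv_of_norm_lt_one _ hVW
  -- Here `e = 1 - (1 - WV) = WV`, so `e⁻¹W` is a left inverse of `V`.
  refine ⟨m, V, e.symm.toContinuousLinearMap.comp W, ?_⟩
  ext x
  have : e x = W (V x) := by simp [he]
  simp [← this]

variable [IsBoundedSMul Aᵐᵒᵖ E] [IsBoundedSMul Aᵐᵒᵖ F] [IsBoundedSMul Aᵐᵒᵖ G]

/-- The morphism `A^n → E`, `c ↦ ∑ x_i c_i`. -/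
def finSum {n : ℕ} (x : Fin n → E) : (Fin n → A) →L[Aᵐᵒᵖ] E where
  toFun c := ∑ i, op (c i) • x i
  map_add' c d := by simp [add_smul, Finset.sum_add_distrib]
  map_smul' a c := by
    induction a
    simp [Finset.smul_sum, mul_smul]
  cont := by
    have : Continuous (op : A → Aᵐᵒᵖ) := continuous_op
    change Continuous fun c : Fin n → A => ∑ i, op (c i) • x i
    fun_prop

theorem finSum_apply {n : ℕ} (x : Fin n → E) (c : Fin n → A) :
    finSum x c = ∑ i, op (c i) • x i := rfl

theorem linearMap_fin_apply {E : Type*} [AddCommGroup E] [Module Aᵐᵒᵖ E] {n : ℕ}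
    (f : (Fin n → A) →ₗ[Aᵐᵒᵖ] E) (c : Fin n → A) :
    f c = ∑ i, op (c i) • f (Pi.single i 1) := by
  conv_lhs => rw [show c = ∑ i, op (c i) • (Pi.single i 1 : Fin n → A) by
    ext j; simp [Finset.sum_apply, Pi.single_apply]]
  simp

theorem finSum_eq {n : ℕ} (f : (Fin n → A) →ₗ[Aᵐᵒᵖ] E) (c : Fin n → A) :
    finSum (fun i => f (Pi.single i 1)) c = f c :=
  (linearMap_fin_apply f c).symm

/-- Morphisms out of `A^n` lift along surjections. -/
theorem exists_fin_lift {n : ℕ} {g : E →L[Aᵐᵒᵖ] F} (hg : Function.Surjective g)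
    (w : (Fin n → A) →L[Aᵐᵒᵖ] F) : ∃ l : (Fin n → A) →L[Aᵐᵒᵖ] E, g.comp l = w := by
  choose x hx using fun i => hg (w (Pi.single i 1))
  refine ⟨finSum x, ?_⟩
  ext c
  rw [ContinuousLinearMap.comp_apply, finSum_apply, map_sum]
  simp_rw [map_smul, hx]
  exact finSum_eq w.toLinearMap c

/-- Linear maps out of a module with `A`-compact identity are continuous. -/
theorem continuous_of_isACompact_id [CompleteSpace E]
    (h : IsACompact (ContinuousLinearMap.id Aᵐᵒᵖ E)) (f : E →ₗ[Aᵐᵒᵖ] F) : Continuous f := by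
  obtain ⟨m, V, W, hVW⟩ := exists_retract_of_isACompact_id h
  -- As `f = (f W) V`, continuity is only needed for linear maps out of `A^m`, which are finite sums
  -- of actions on fixed vectors.
  have : (f : E → F) = fun x => finSum (fun i => f (W (Pi.single i 1))) (V x) := by
    ext x
    exact (congrArg f (DFunLike.congr_fun hVW x).symm).trans
      (finSum_eq (f ∘ₗ W.toLinearMap) (V x)).symm
  rw [this]
  exact (finSum _).continuous.comp V.continuous

/-- A linear isomorphism between modules with `A`-compact identities is an isomorphism of Banach
modules. -/
def continuousEquiv [CompleteSpace E] [CompleteSpace F]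
    (hE : IsACompact (ContinuousLinearMap.id Aᵐᵒᵖ E))
    (hF : IsACompact (ContinuousLinearMap.id Aᵐᵒᵖ F)) (e : E ≃ₗ[Aᵐᵒᵖ] F) : E ≃L[Aᵐᵒᵖ] F where
  toLinearEquiv := e
  continuous_toFun := continuous_of_isACompact_id hE e.toLinearMap
  continuous_invFun := continuous_of_isACompact_id hF e.symm.toLinearMap

theorem isACompact_id_prod (hE : IsACompact (ContinuousLinearMap.id Aᵐᵒᵖ E))
    (hF : IsACompact (ContinuousLinearMap.id Aᵐᵒᵖ F)) :
    IsACompact (ContinuousLinearMap.id Aᵐᵒᵖ (E × F)) := by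
  convert! ((hE.comp_right (ContinuousLinearMap.fst Aᵐᵒᵖ E F)).comp_left
    (ContinuousLinearMap.inl Aᵐᵒᵖ E F)).add ((hF.comp_right
    (ContinuousLinearMap.snd Aᵐᵒᵖ E F)).comp_left (ContinuousLinearMap.inr Aᵐᵒᵖ E F)) using 1
  ext x <;> simp

theorem finite_of_isACompact_id [CompleteSpace E]
    (h : IsACompact (ContinuousLinearMap.id Aᵐᵒᵖ E)) : Module.Finite Aᵐᵒᵖ E := by
  obtain ⟨m, V, W, hVW⟩ := exists_retract_of_isACompact_id h
  exact Module.Finite.of_surjective W.toLinearMap fun x => ⟨V x, DFunLike.congr_fun hVW x⟩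

theorem projective_of_isACompact_id [CompleteSpace E]
    (h : IsACompact (ContinuousLinearMap.id Aᵐᵒᵖ E)) : Module.Projective Aᵐᵒᵖ E := by
  obtain ⟨m, V, W, hVW⟩ := exists_retract_of_isACompact_id h
  exact Module.Projective.of_split V.toLinearMap W.toLinearMap
    (LinearMap.ext fun x => DFunLike.congr_fun hVW x)

end FiniteRank

section

/-! ### Classes and equality in `K_0` -/

section KZeroClass

variable {A : Type u} [Ring A] {P Q : Type u} [AddCommGroup P] [Module Aᵐᵒᵖ P]
  [Module.Finite Aᵐᵒᵖ P] [Module.Projective Aᵐᵒᵖ P] [AddCommGroup Q] [Module Aᵐᵒᵖ Q]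
  [Module.Finite Aᵐᵒᵖ Q] [Module.Projective Aᵐᵒᵖ Q]

theorem K0.cls_congr (e : P ≃ₗ[Aᵐᵒᵖ] Q) : K0.cls A P = K0.cls A Q :=
  congrArg (Algebra.GrothendieckAddGroup.of (M := FGProjClass A))
    (Quotient.sound (a := (⟨P⟩ : FGProj A)) (b := ⟨Q⟩) ⟨e⟩)

theorem K0.cls_prod : K0.cls A (P × Q) = K0.cls A P + K0.cls A Q :=
  (Algebra.GrothendieckAddGroup.of (M := FGProjClass A)).map_add
    (Quotient.mk (FGProj.setoid A) ⟨P⟩) (Quotient.mk (FGProj.setoid A) ⟨Q⟩)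

/-- The Grothendieck group is the localization at the whole monoid, where equality means equality
after adding some class. The module `R` is later absorbed into a degenerate summand `(X, X, 1, 1)`.
-/
theorem K0.cls_eq_iff : K0.cls A P = K0.cls A Q ↔ ∃ R : FGProj A,
    Nonempty ((R.carrier × P) ≃ₗ[Aᵐᵒᵖ] (R.carrier × Q)) := by
  constructor
  · intro h
    obtain ⟨c, hc⟩ := (AddLocalization.addMonoidOf (⊤ : AddSubmonoid (FGProjClass A))).eq_iff_exists.1 h
    obtain ⟨⟨R⟩, _⟩ := c
    exact ⟨R, Quotient.exact hc⟩
  · rintro ⟨R, ⟨e⟩⟩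
    have := K0.cls_congr e
    rw [K0.cls_prod, K0.cls_prod] at this
    exact add_left_cancel this

theorem K0.exists_eq_sub (z : K0 A) :
    ∃ P Q : FGProj A, z = K0.cls A P.carrier - K0.cls A Q.carrier := by
  obtain ⟨⟨p, q⟩, h⟩ := (AddLocalization.addMonoidOf (⊤ : AddSubmonoid (FGProjClass A))).surj z
  obtain ⟨P, rfl⟩ := Quotient.exists_rep p
  obtain ⟨⟨Q⟩, _⟩ := q
  exact ⟨P, Q, eq_sub_of_add_eq h⟩

theorem K0.hom_ext {H : Type*} [AddGroup H] {f g : K0 A →+ H}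
    (h : ∀ P : FGProj A, f (K0.cls A P.carrier) = g (K0.cls A P.carrier)) : f = g := by
  ext z
  obtain ⟨P, Q, rfl⟩ := K0.exists_eq_sub z
  rw [map_sub, map_sub, h, h]

end KZeroClass

/-! ### Kernels and split surjections -/

section Kernels

variable {R : Type*} [Ring R] {M N E M' E' : Type*} [AddCommGroup M] [Module R M] [AddCommGroup N]
  [Module R N] [AddCommGroup E] [Module R E] [AddCommGroup M'] [Module R M'] [AddCommGroup E']
  [Module R E']

/-- Isomorphic maps have isomorphic kernels. -/
def kerEquiv (g : M →ₗ[R] E) (g' : M' →ₗ[R] E') (e : M ≃ₗ[R] M')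
    (h : ∀ x, g x = 0 ↔ g' (e x) = 0) : LinearMap.ker g ≃ₗ[R] LinearMap.ker g' :=
  e.ofSubmodules _ _ (by
    ext y
    obtain ⟨x, rfl⟩ := e.surjective y
    simp [← h])

/-- If `w` lifts through `g`, then `ker (g, w) = ker g ⊕ N`. -/
def kerCoprodEquiv (g : M →ₗ[R] E) (w : N →ₗ[R] E) (l : N →ₗ[R] M) (hl : g ∘ₗ l = w) :
    (LinearMap.ker g × N) ≃ₗ[R] LinearMap.ker (g.coprod w) where
  toFun z := ⟨(z.1.1 - l z.2, z.2), by
    have h1 : g z.1.1 = 0 := z.1.2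
    simp [← hl, h1]⟩
  map_add' y z := by ext <;> simp [add_sub_add_comm]
  map_smul' c z := by ext <;> simp [smul_sub]
  invFun z := (⟨z.1.1 + l z.1.2, by
    have h1 : g z.1.1 + w z.1.2 = 0 := z.2
    have h2 : g (l z.1.2) = w z.1.2 := LinearMap.congr_fun hl _
    rw [LinearMap.mem_ker, map_add, h2, h1]⟩, z.1.2)
  left_inv z := by ext <;> simp
  right_inv z := by ext <;> simp

end Kernels

variable {A : Type u} [NormedRing A] [NormedAlgebra ℂ A] [CompleteSpace A]

section SplitSurjection

variable {E F : Type u}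
  [NormedAddCommGroup E] [NormedSpace ℂ E] [Module Aᵐᵒᵖ E] [IsScalarTower ℂ Aᵐᵒᵖ E]
  [NormedAddCommGroup F] [NormedSpace ℂ F] [Module Aᵐᵒᵖ F] [IsScalarTower ℂ Aᵐᵒᵖ F]

instance [CompleteSpace E] (g : E →L[Aᵐᵒᵖ] F) : CompleteSpace (LinearMap.ker g.toLinearMap) :=
  IsClosed.completeSpace_coe (hs := g.isClosed_ker)

instance [IsBoundedSMul Aᵐᵒᵖ E] (p : Submodule Aᵐᵒᵖ E) : IsBoundedSMul Aᵐᵒᵖ p :=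
  IsBoundedSMul.of_norm_smul_le fun a x => norm_smul_le a x.1

/-- The inclusion of the kernel. -/
def kerIncl (g : E →L[Aᵐᵒᵖ] F) : LinearMap.ker g.toLinearMap →L[Aᵐᵒᵖ] E :=
  (LinearMap.ker g.toLinearMap).subtypeL

/-- The projection onto the kernel given by a right inverse. -/
def kerProj (g : E →L[Aᵐᵒᵖ] F) (r : F →L[Aᵐᵒᵖ] E) (h : g.comp r = ContinuousLinearMap.id Aᵐᵒᵖ F) :
    E →L[Aᵐᵒᵖ] LinearMap.ker g.toLinearMap :=
  (ContinuousLinearMap.id Aᵐᵒᵖ E - r.comp g).codRestrict _ fun x => by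
    have : g (r (g x)) = g x := DFunLike.congr_fun h (g x)
    simp [this]

variable (g : E →L[Aᵐᵒᵖ] F) (r : F →L[Aᵐᵒᵖ] E) (h : g.comp r = ContinuousLinearMap.id Aᵐᵒᵖ F)

theorem comp_kerIncl : g.comp (kerIncl g) = 0 := by
  ext x
  exact x.2

theorem kerIncl_comp_kerProj :
    (kerIncl g).comp (kerProj g r h) = ContinuousLinearMap.id Aᵐᵒᵖ E - r.comp g := rfl

theorem kerProj_comp_kerIncl :
    (kerProj g r h).comp (kerIncl g) = ContinuousLinearMap.id Aᵐᵒᵖ _ := by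
  ext x
  have : g x.1 = 0 := x.2
  change x.1 - r (g x.1) = x.1
  simp [this]

/-- A split surjection `E → F` gives `E = ker ⊕ F`. -/
def kerProdEquiv : E ≃L[Aᵐᵒᵖ] (LinearMap.ker g.toLinearMap × F) :=
  ContinuousLinearEquiv.equivOfInverse ((kerProj g r h).prod g) ((kerIncl g).coprod r)
    (fun x => by
      change (x - r (g x)) + r (g x) = x
      simp)
    (fun y => by
      have h1 : g y.1.1 = 0 := y.1.2
      have h2 : g (r y.2) = y.2 := DFunLike.congr_fun h y.2
      ext
      · change (y.1.1 + r y.2) - r (g (y.1.1 + r y.2)) = y.1.1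
        simp [h1, h2]
      · change g (y.1.1 + r y.2) = y.2
        simp [h1, h2])

end SplitSurjection

/-! ### The index of a Fredholm module -/

namespace FredholmModule

variable (F G : FredholmModule A)

theorem nonempty_stabilization : Nonempty F.Stabilization := by
  obtain ⟨m, V, W, hVW⟩ := F.compact₁.neg.exists_factor one_pos
  -- With `WV` within distance less than `1` of `1 - uv`, this `e` is `uv + WV`; its invertibility
  -- makes `(u, W)` onto.
  obtain ⟨e, he⟩ := exists_equiv_of_norm_lt_one _ hVW
  refine ⟨⟨m, W, isACompact_of_fin W, fun y => ?_⟩⟩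
  obtain ⟨x, rfl⟩ := e.surjective y
  refine ⟨(F.v x, V x), ?_⟩
  rw [he]
  simp only [ContinuousLinearMap.coprod_apply, sub_apply, neg_apply,
    ContinuousLinearMap.comp_apply, ContinuousLinearMap.id_apply]
  abel

namespace Stabilization

variable {F G} (s : F.Stabilization)

/-- A continuous surjection of Banach modules need not split. Here `uv + WV` is invertible, `u` is
the restriction of `(u, w)` to `E₀`, and `W` lifts to some `l` since its source is free; hence `(v +
l V)(uv + WV)⁻¹` is a right inverse. -/
theorem exists_rightInverse : ∃ r : F.E₁ →L[Aᵐᵒᵖ] F.E₀ × (Fin s.n → A),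
    (F.u.coprod s.w).comp r = ContinuousLinearMap.id Aᵐᵒᵖ F.E₁ := by
  obtain ⟨m, V, W, hVW⟩ := F.compact₁.neg.exists_factor one_pos
  obtain ⟨e, he⟩ := exists_equiv_of_norm_lt_one _ hVW
  obtain ⟨l, hl⟩ := exists_fin_lift s.surjective W
  refine ⟨((ContinuousLinearMap.inl Aᵐᵒᵖ F.E₀ (Fin s.n → A)).comp F.v + l.comp V).comp
    e.symm.toContinuousLinearMap, ?_⟩
  ext y
  obtain ⟨x, rfl⟩ := e.surjective y
  have h1 : (F.u.coprod s.w) (l (V x)) = W (V x) := DFunLike.congr_fun hl (V x)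
  have h2 : (F.u.coprod s.w) (F.v x, 0) = F.u (F.v x) := by simp
  change (F.u.coprod s.w) ((F.v (e.symm (e x)), 0) + l (V (e.symm (e x)))) = e x
  rw [e.symm_apply_apply, map_add, h1, h2, he]
  simp only [sub_apply, neg_apply, ContinuousLinearMap.comp_apply, ContinuousLinearMap.id_apply]
  abel

/-- The map `(v, 0)` is a parametrix of `g = (u, w)`: `1 - (v, 0) g` is compact on `E₀ ⊕ A^n`,
because `1 - vu` is compact and the rest factors through `A^n`. On `ker g` this operator is the
identity, and the projection onto the kernel compresses it. -/
theorem isACompact_id_kernel : IsACompact (ContinuousLinearMap.id Aᵐᵒᵖ s.kernel) := by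
  obtain ⟨r, hr⟩ := s.exists_rightInverse
  let g := F.u.coprod s.w
  let inl := ContinuousLinearMap.inl Aᵐᵒᵖ F.E₀ (Fin s.n → A)
  have h1 : IsACompact (ContinuousLinearMap.id Aᵐᵒᵖ _ - (inl.comp F.v).comp g) := by
    convert! (((F.compact₀.comp_right (ContinuousLinearMap.fst Aᵐᵒᵖ F.E₀ (Fin s.n → A))).comp_left
      inl).add ((isACompact_of_fin ((inl.comp F.v).comp s.w -
        ContinuousLinearMap.inr Aᵐᵒᵖ F.E₀ (Fin s.n → A))).comp_right
      (ContinuousLinearMap.snd Aᵐᵒᵖ F.E₀ (Fin s.n → A)))).neg using 1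
    ext x <;> simp [g, inl]
  have h2 := (h1.comp_left (kerProj g r hr)).comp_right (kerIncl g)
  convert! h2 using 1
  ext1 x
  have hx : g x.1 = 0 := x.2
  have h3 : kerProj g r hr x.1 = x := DFunLike.congr_fun (kerProj_comp_kerIncl g r hr) x
  change x = kerProj g r hr (x.1 - inl (F.v (g x.1)))
  rw [hx, map_zero, map_zero, sub_zero, h3]

instance : Module.Finite Aᵐᵒᵖ s.kernel := by
  have := s.isACompact_id_kernel
  exact finite_of_isACompact_id this

instance : Module.Projective Aᵐᵒᵖ s.kernel :=
  projective_of_isACompact_id s.isACompact_id_kernel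

/-- Schanuel's argument: both sides are the kernel of `(u, w_s, w_t)` on `E₀ ⊕ A^{n_s} ⊕ A^{n_t}`,
since each of `w_s`, `w_t` lifts through the surjection made with the other. -/
theorem nonempty_equiv (t : F.Stabilization) :
    Nonempty ((s.kernel × (Fin t.n → A)) ≃ₗ[Aᵐᵒᵖ] (t.kernel × (Fin s.n → A))) := by
  obtain ⟨l, hl⟩ := exists_fin_lift s.surjective t.w
  obtain ⟨k, hk⟩ := exists_fin_lift t.surjective s.w
  let e : ((F.E₀ × (Fin s.n → A)) × (Fin t.n → A)) ≃ₗ[Aᵐᵒᵖ]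
      ((F.E₀ × (Fin t.n → A)) × (Fin s.n → A)) :=
    { toFun := fun x => ((x.1.1, x.2), x.1.2)
      map_add' := fun _ _ => rfl
      map_smul' := fun _ _ => rfl
      invFun := fun x => ((x.1.1, x.2), x.1.2)
      left_inv := fun _ => rfl
      right_inv := fun _ => rfl }
  refine ⟨(kerCoprodEquiv (F.u.coprod s.w).toLinearMap t.w.toLinearMap l.toLinearMap
    (congrArg (fun f => f.toLinearMap) hl)).trans ((kerEquiv _ _ e ?_).trans
    (kerCoprodEquiv (F.u.coprod t.w).toLinearMap s.w.toLinearMap k.toLinearMap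
    (congrArg (fun f => f.toLinearMap) hk)).symm)⟩
  intro x
  have : F.u x.1.1 + s.w x.1.2 + t.w x.2 = F.u x.1.1 + t.w x.2 + s.w x.1.2 := by abel
  simp [e, this]

theorem cls_sub_cls (t : F.Stabilization) :
    K0.cls A s.kernel - K0.cls A (Fin s.n → A) = K0.cls A t.kernel - K0.cls A (Fin t.n → A) := by
  obtain ⟨e⟩ := s.nonempty_equiv t
  have h := K0.cls_congr e
  rw [K0.cls_prod, K0.cls_prod] at h
  rwa [sub_eq_sub_iff_add_eq_add]

end Stabilization

/-- The index `[ker (u, w)] - [A^n]`. -/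
def index : K0 A :=
  let s := F.nonempty_stabilization.some
  K0.cls A s.kernel - K0.cls A (Fin s.n → A)

variable {F G}

theorem index_eq (s : F.Stabilization) :
    F.index = K0.cls A s.kernel - K0.cls A (Fin s.n → A) :=
  Stabilization.cls_sub_cls _ s

theorem Iso.index_eq (h : Iso F G) : F.index = G.index := by
  obtain ⟨e₀, e₁, hu, -⟩ := h
  let s := F.nonempty_stabilization.some
  have hg : ∀ x c, e₁ (F.u.coprod s.w (x, c)) =
      G.u.coprod (e₁.toContinuousLinearMap.comp s.w) (e₀ x, c) := by
    intro x c
    simp [hu]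
  obtain ⟨t, ⟨e⟩, ht⟩ : ∃ t : G.Stabilization, Nonempty (s.kernel ≃ₗ[Aᵐᵒᵖ] t.kernel) ∧
      K0.cls A (Fin s.n → A) = K0.cls A (Fin t.n → A) := by
    -- The stabilization of `F` is carried to `G` along `e₁`, with the same `n` and an isomorphic
    -- kernel.
    refine ⟨⟨s.n, e₁.toContinuousLinearMap.comp s.w, isACompact_of_fin _, ?_⟩, ⟨?_⟩, rfl⟩
    · intro y
      obtain ⟨y, rfl⟩ := e₁.surjective y
      obtain ⟨⟨x, c⟩, rfl⟩ := s.surjective y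
      exact ⟨(e₀ x, c), (hg x c).symm⟩
    · refine kerEquiv _ _ (LinearEquiv.prodCongr e₀.toLinearEquiv (LinearEquiv.refl _ _)) ?_
      rintro ⟨x, c⟩
      have h1 := hg x c
      constructor
      · intro h
        have h : F.u.coprod s.w (x, c) = 0 := h
        rw [h, map_zero] at h1
        exact h1.symm
      · intro h
        exact e₁.injective ((h1.trans h).trans (map_zero e₁).symm)
  rw [FredholmModule.index_eq s, FredholmModule.index_eq t, K0.cls_congr e, ht]

end FredholmModule

end

section

/-! ### Dual bases and the functoriality of `K_0` -/

section AlgebraicBaseChange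

variable {A B C : Type u} [Ring A] [Ring B] [Ring C] (θ : A →+* B) (φ : B →+* C)

/-- `f ⊗ 1 : P ⊗_A B → A ⊗_A B = B`. -/
def BaseChange.functional {P : Type u} [AddCommGroup P] [Module Aᵐᵒᵖ P] (f : P →ₗ[Aᵐᵒᵖ] A) :
    BaseChange θ P →ₗ[Bᵐᵒᵖ] B :=
  BaseChange.lift θ (θ.toAddMonoidHom.comp f.toAddMonoidHom) (by intro a x; simp)

theorem BaseChange.functional_tmul {P : Type u} [AddCommGroup P] [Module Aᵐᵒᵖ P]
    (f : P →ₗ[Aᵐᵒᵖ] A) (x : P) (b : B) :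
    BaseChange.functional θ f (BaseChange.tmul θ x b) = θ (f x) * b := rfl

/-- `b ↦ x ⊗ b`. -/
def BaseChange.vector {P : Type u} [AddCommGroup P] [Module Aᵐᵒᵖ P] (x : P) :
    B →ₗ[Bᵐᵒᵖ] BaseChange θ P where
  toFun b := BaseChange.tmul θ x b
  map_add' := BaseChange.tmul_add_right θ x
  map_smul' _ _ := rfl

theorem BaseChange.vector_apply {P : Type u} [AddCommGroup P] [Module Aᵐᵒᵖ P] (x : P) (b : B) :
    BaseChange.vector θ x b = BaseChange.tmul θ x b := rfl

/-- A finitely generated projective module has a finite dual basis. -/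
theorem exists_dualBasis (P : Type u) [AddCommGroup P] [Module Aᵐᵒᵖ P] [Module.Finite Aᵐᵒᵖ P]
    [Module.Projective Aᵐᵒᵖ P] : ∃ (n : ℕ) (x : Fin n → P) (f : Fin n → P →ₗ[Aᵐᵒᵖ] A),
      ∀ y, ∑ i, op (f i y) • x i = y := by
  obtain ⟨n, p, hp⟩ := Module.Finite.exists_fin' Aᵐᵒᵖ P
  obtain ⟨i, hi⟩ := Module.projective_lifting_property p LinearMap.id hp
  refine ⟨n, fun j => p (Pi.single j 1), fun j =>
    (MulOpposite.opLinearEquiv Aᵐᵒᵖ : A ≃ₗ[Aᵐᵒᵖ] Aᵐᵒᵖ).symm.toLinearMap ∘ₗ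
      LinearMap.proj j ∘ₗ i, fun y => ?_⟩
  have h1 : ∑ j, (i y j) • (Pi.single j 1 : Fin n → Aᵐᵒᵖ) = i y := by
    ext k
    simp [Finset.sum_apply, Pi.single_apply]
  calc _ = p (∑ j, (i y j) • (Pi.single j 1 : Fin n → Aᵐᵒᵖ)) := by simp
    _ = y := by rw [h1]; exact LinearMap.congr_fun hi y

theorem BaseChange.sum_tmul {P : Type u} [AddCommGroup P] [Module Aᵐᵒᵖ P] {n : ℕ}
    {x : Fin n → P} {f : Fin n → P →ₗ[Aᵐᵒᵖ] A} (h : ∀ y, ∑ i, op (f i y) • x i = y) (y : P)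
    (b : B) : ∑ i, BaseChange.tmul θ (x i) (θ (f i y) * b) = BaseChange.tmul θ y b := by
  simp_rw [← BaseChange.tmul_balanced]
  rw [← BaseChange.tmul_sum_left, h]

/-- `P ⊗_A A = P`. -/
def BaseChange.idEquiv (P : Type u) [AddCommGroup P] [Module Aᵐᵒᵖ P] :
    BaseChange (RingHom.id A) P ≃ₗ[Aᵐᵒᵖ] P :=
  LinearEquiv.ofLinearMap (BaseChange.lift (RingHom.id A) (AddMonoidHom.id P) (by simp))
    { toFun := fun x => BaseChange.tmul (RingHom.id A) x 1
      map_add' := fun x y => BaseChange.tmul_add_left _ x y 1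
      map_smul' := by
        intro r x
        induction r
        simp [BaseChange.tmul_balanced, BaseChange.op_smul_tmul] }
    (by ext x; simp)
    (BaseChange.hom_ext _ fun x b => by simp [BaseChange.tmul_balanced])

/-- `P ⊗_A C = (P ⊗_A B) ⊗_B C` for a finitely generated projective module `P`. -/
theorem BaseChange.nonempty_compEquiv (P : Type u) [AddCommGroup P] [Module Aᵐᵒᵖ P]
    [Module.Finite Aᵐᵒᵖ P] [Module.Projective Aᵐᵒᵖ P] :
    Nonempty (BaseChange (φ.comp θ) P ≃ₗ[Cᵐᵒᵖ] BaseChange φ (BaseChange θ P)) := by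
  obtain ⟨n, x, f, h⟩ := exists_dualBasis (A := A) P
  let g : BaseChange (φ.comp θ) P →ₗ[Cᵐᵒᵖ] BaseChange φ (BaseChange θ P) :=
    BaseChange.lift (φ.comp θ)
      (AddMonoidHom.mk' (fun y => BaseChange.tmul φ (BaseChange.tmul θ y 1) 1) (by
        intro y z; rw [BaseChange.tmul_add_left, BaseChange.tmul_add_left]))
      (by
        intro a y
        simp only [AddMonoidHom.mk'_apply, BaseChange.op_smul_tmul, RingHom.comp_apply,
          BaseChange.tmul_balanced, mul_one, one_mul]
        rw [← mul_one (φ (θ a)), ← BaseChange.tmul_balanced, BaseChange.op_smul_tmul, one_mul])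
  have hg : ∀ y c, g (BaseChange.tmul _ y c) = BaseChange.tmul φ (BaseChange.tmul θ y 1) c := by
    intro y c
    simp [g, BaseChange.op_smul_tmul]
  -- The inverse is written with a dual basis as a sum of known linear maps, which leaves no
  -- balancing relation to verify.
  let k : BaseChange φ (BaseChange θ P) →ₗ[Cᵐᵒᵖ] BaseChange (φ.comp θ) P :=
    ∑ i, BaseChange.vector (φ.comp θ) (x i) ∘ₗ
      BaseChange.functional φ (BaseChange.functional θ (f i))
  have hk : ∀ y b c, k (BaseChange.tmul φ (BaseChange.tmul θ y b) c) =
      BaseChange.tmul (φ.comp θ) y (φ b * c) := by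
    intro y b c
    rw [← BaseChange.sum_tmul (φ.comp θ) h]
    simp [k, BaseChange.functional_tmul, BaseChange.vector_apply, mul_assoc]
  refine ⟨LinearEquiv.ofLinearMap g k (BaseChange.hom_ext _ fun z c => ?_)
    (BaseChange.hom_ext _ fun y c => by simp [hg, hk])⟩
  induction z using BaseChange.induction θ with
  | h0 => simp [BaseChange.tmul_zero_left]
  | ht y b =>
    rw [LinearMap.comp_apply, hk, hg, ← BaseChange.tmul_balanced, BaseChange.op_smul_tmul, one_mul]
    rfl
  | ha y z hy hz => rw [BaseChange.tmul_add_left, map_add, map_add, hy, hz]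

/-- `A^n ⊗_A B = B^n`. -/
def BaseChange.finEquiv (n : ℕ) : BaseChange θ (Fin n → A) ≃ₗ[Bᵐᵒᵖ] (Fin n → B) :=
  LinearEquiv.ofLinearMap
    (LinearMap.pi fun i => BaseChange.functional θ (LinearMap.proj i))
    (∑ i, BaseChange.vector θ (Pi.single i 1) ∘ₗ LinearMap.proj i)
    (by
      ext c j
      simp [BaseChange.functional_tmul, BaseChange.vector_apply, Pi.single_apply, apply_ite θ])
    (BaseChange.hom_ext _ fun x b => by
      have := BaseChange.sum_tmul θ (x := fun i : Fin n => (Pi.single i 1 : Fin n → A))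
        (f := fun i => LinearMap.proj i)
        (fun y => by ext j; simp [Finset.sum_apply, Pi.single_apply]) x b
      simpa [BaseChange.functional_tmul, BaseChange.vector_apply] using this)

theorem K0.map_id : K0.map (RingHom.id A) = AddMonoidHom.id (K0 A) :=
  K0.hom_ext fun P => by
    rw [K0.map_cls, K0.cls_congr (BaseChange.idEquiv P.carrier), AddMonoidHom.id_apply]

theorem K0.map_comp : K0.map (φ.comp θ) = (K0.map φ).comp (K0.map θ) :=
  K0.hom_ext fun P => by
    obtain ⟨e⟩ := BaseChange.nonempty_compEquiv θ φ P.carrier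
    rw [AddMonoidHom.comp_apply, K0.map_cls, K0.map_cls, K0.map_cls, K0.cls_congr e]

end AlgebraicBaseChange

variable {A B : Type u} [NormedRing A] [NormedAlgebra ℂ A] [CompleteSpace A]
  [NormedRing B] [NormedAlgebra ℂ B] [CompleteSpace B] (θ : BanachAlgHom A B)

/-! ### Completed tensor products of summands, kernels and sums -/

section CompletedBaseChange

variable {E F : Type u}
  [NormedAddCommGroup E] [NormedSpace ℂ E] [Module Aᵐᵒᵖ E] [IsScalarTower ℂ Aᵐᵒᵖ E]
  [NormedAddCommGroup F] [NormedSpace ℂ F] [Module Aᵐᵒᵖ F] [IsScalarTower ℂ Aᵐᵒᵖ F]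
  [IsBoundedSMul Aᵐᵒᵖ E] [IsBoundedSMul Aᵐᵒᵖ F]

theorem ctmul_sum_left {ι : Type*} (s : Finset ι) (f : ι → E) (b : B) :
    ctmul θ (∑ i ∈ s, f i) b = ∑ i ∈ s, ctmul θ (f i) b :=
  map_sum (AddMonoidHom.mk' (fun x : E => ctmul θ x b) fun x y => ctmul_add_left θ x y b) f s

theorem cmap_zero : cmap θ (0 : E →L[Aᵐᵒᵖ] F) = 0 := by
  rw [← sub_self (0 : E →L[Aᵐᵒᵖ] F), cmap_sub, sub_self]

/-- The canonical map from the algebraic to the completed tensor product. -/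
def toCompleted : BaseChange θ.ringHom E →ₗ[Bᵐᵒᵖ] CompletedTensor θ E :=
  BaseChange.lift θ.ringHom
    (AddMonoidHom.mk' (fun x => ctmul θ x 1) fun x y => ctmul_add_left θ x y 1)
    (by intro a x; simp [ctmul_balanced, op_smul_ctmul])

theorem toCompleted_tmul (x : E) (b : B) :
    toCompleted θ (BaseChange.tmul θ.ringHom x b) = ctmul θ x b := by
  simp [toCompleted, op_smul_ctmul]

/-- For a direct summand of `A^m`, the algebraic tensor product is complete. -/
def completedEquiv {m : ℕ} (V : E →L[Aᵐᵒᵖ] (Fin m → A)) (W : (Fin m → A) →L[Aᵐᵒᵖ] E)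
    (h : W.comp V = ContinuousLinearMap.id Aᵐᵒᵖ E) :
    BaseChange θ.ringHom E ≃ₗ[Bᵐᵒᵖ] CompletedTensor θ E :=
  have hsum : ∀ y, ∑ i, op (V y i) • W (Pi.single i 1) = y := fun y =>
    (linearMap_fin_apply W.toLinearMap (V y)).symm.trans (DFunLike.congr_fun h y)
  LinearEquiv.ofLinearMap (toCompleted θ)
    -- The coordinates of a completed tensor lie in `B` because `B` is complete, and the finite dual
    -- basis reassembles them into an algebraic tensor.
    (∑ i, BaseChange.vector θ.ringHom (W (Pi.single i 1)) ∘ₗ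
      (cfunctional θ ((ContinuousLinearMap.proj i).comp V)).toLinearMap)
    (by
      have h1 : ∑ i, (cvector θ (W (Pi.single i 1))).comp
          (cfunctional θ ((ContinuousLinearMap.proj i).comp V)) =
          ContinuousLinearMap.id Bᵐᵒᵖ (CompletedTensor θ E) := by
        refine CompletedTensor.hom_ext θ fun x b => ?_
        conv_rhs => rw [ContinuousLinearMap.id_apply, ← hsum x, ctmul_sum_left]
        simp only [sum_apply, ContinuousLinearMap.comp_apply, cfunctional_ctmul, ctmul_balanced]
        rfl
      ext z
      conv_rhs => rw [LinearMap.id_apply, ← ContinuousLinearMap.id_apply (R₁ := Bᵐᵒᵖ) z, ← h1]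
      simp [BaseChange.vector_apply, toCompleted_tmul]
      rfl)
    (BaseChange.hom_ext _ fun x b => by
      have := BaseChange.sum_tmul θ.ringHom
        (f := fun i => ((ContinuousLinearMap.proj (R := Aᵐᵒᵖ) (φ := fun _ : Fin m => A) i).comp
          V).toLinearMap) hsum x b
      simpa [toCompleted_tmul, cfunctional_ctmul, BaseChange.vector_apply] using this)

/-- The kernel of `g ⊗ 1` for a split surjection `g`. -/
def kerCmapEquiv (g : E →L[Aᵐᵒᵖ] F) (r : F →L[Aᵐᵒᵖ] E)
    (h : g.comp r = ContinuousLinearMap.id Aᵐᵒᵖ F) :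
    CompletedTensor θ (LinearMap.ker g.toLinearMap) ≃ₗ[Bᵐᵒᵖ]
      LinearMap.ker (cmap θ g).toLinearMap where
  toLinearMap := (cmap θ (kerIncl g)).toLinearMap.codRestrict _ fun z => by
    change cmap θ g (cmap θ (kerIncl g) z) = 0
    rw [← ContinuousLinearMap.comp_apply, ← cmap_comp, comp_kerIncl]
    exact DFunLike.congr_fun (cmap_zero θ) z
  -- The completed tensor product need not preserve kernels in general. For a split surjection the
  -- projection onto the kernel survives tensoring and gives the inverse.
  invFun z := cmap θ (kerProj g r h) z.1
  left_inv z := by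
    change cmap θ (kerProj g r h) (cmap θ (kerIncl g) z) = z
    rw [← ContinuousLinearMap.comp_apply, ← cmap_comp, kerProj_comp_kerIncl, cmap_id]
    rfl
  right_inv z := by
    ext1
    change cmap θ (kerIncl g) (cmap θ (kerProj g r h) z.1) = z.1
    have hz : cmap θ g z.1 = 0 := z.2
    rw [← ContinuousLinearMap.comp_apply, ← cmap_comp, kerIncl_comp_kerProj, cmap_sub, cmap_id,
      cmap_comp, sub_apply, ContinuousLinearMap.comp_apply, hz, map_zero, sub_zero]
    rfl

/-- `(E ⊕ A^n) ⊗_A B = (E ⊗_A B) ⊕ B^n`. -/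
def completedProdEquiv (n : ℕ) :
    CompletedTensor θ (E × (Fin n → A)) ≃L[Bᵐᵒᵖ] CompletedTensor θ E × (Fin n → B) :=
  let f := (cmap θ (ContinuousLinearMap.fst Aᵐᵒᵖ E (Fin n → A))).prod
    (ContinuousLinearMap.pi fun i => cfunctional θ
      ((ContinuousLinearMap.proj i).comp (ContinuousLinearMap.snd Aᵐᵒᵖ E (Fin n → A))))
  let g := (cmap θ (ContinuousLinearMap.inl Aᵐᵒᵖ E (Fin n → A))).coprod
    (finSum fun i => ctmul θ ((0, Pi.single i 1) : E × (Fin n → A)) 1)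
  have hf : ∀ x a b, f (ctmul θ (x, a) b) = (ctmul θ x b, fun i => θ.ringHom (a i) * b) := by
    intro x a b
    simp only [f, ContinuousLinearMap.prod_apply, cmap_ctmul]
    refine Prod.ext rfl (funext fun i => ?_)
    exact cfunctional_ctmul θ _ _ _
  ContinuousLinearEquiv.equivOfInverse f g
    (fun z => DFunLike.congr_fun (f := g.comp f) (g := ContinuousLinearMap.id Bᵐᵒᵖ _)
      (CompletedTensor.hom_ext θ fun x b => by
        obtain ⟨x, a⟩ := x
        rw [ContinuousLinearMap.comp_apply, hf]
        simp only [g, ContinuousLinearMap.coprod_apply, cmap_ctmul, finSum_apply, op_smul_ctmul,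
          one_mul, ContinuousLinearMap.id_apply, ← ctmul_balanced]
        rw [← ctmul_sum_left, ← ctmul_add_left]
        congr 1
        ext j <;> simp [Prod.fst_sum, Prod.snd_sum, Finset.sum_apply, Pi.single_apply]) z)
    (by
      rintro ⟨y, c⟩
      have h1 : f.comp (cmap θ (ContinuousLinearMap.inl Aᵐᵒᵖ E (Fin n → A))) =
          ContinuousLinearMap.inl Bᵐᵒᵖ _ _ := CompletedTensor.hom_ext θ fun x b => by
        rw [ContinuousLinearMap.comp_apply, cmap_ctmul, ContinuousLinearMap.inl_apply, hf]
        refine Prod.ext rfl (funext fun i => ?_)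
        simp
      have h0 : ctmul θ (0 : E) (1 : B) = 0 := by
        have := ctmul_add_left θ (0 : E) 0 (1 : B)
        simpa using this
      have h2 : f (cmap θ (ContinuousLinearMap.inl Aᵐᵒᵖ E (Fin n → A)) y) = (y, 0) :=
        DFunLike.congr_fun h1 y
      simp only [g, ContinuousLinearMap.coprod_apply, map_add]
      rw [h2, finSum_apply, map_sum]
      simp only [map_smul, hf, h0]
      ext j <;> simp [Prod.fst_sum, Prod.snd_sum, Finset.sum_apply, Pi.single_apply,
        apply_ite θ.ringHom])

theorem completedProdEquiv_ctmul (n : ℕ) (x : E) (a : Fin n → A) (b : B) :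
    completedProdEquiv θ n (ctmul θ (x, a) b) = (ctmul θ x b, fun i => θ.ringHom (a i) * b) := by
  refine Prod.ext (cmap_ctmul θ _ _ _) (funext fun i => ?_)
  exact cfunctional_ctmul θ _ _ _

end CompletedBaseChange

/-! ### Naturality of the index -/

namespace FredholmModule

/-- The image `w ⊗ 1` stabilizes the image of `F`, the tensored right inverse giving surjectivity.
Its kernel is the completed tensor product of `ker (u, w)` by splitness, and this is the algebraic
one because `ker (u, w)` is a summand of some `A^m`. -/
theorem index_baseChange (F : FredholmModule A) :
    (F.baseChange θ).index = K0.map θ.ringHom F.index := by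
  let s := F.nonempty_stabilization.some
  obtain ⟨r, hr⟩ := s.exists_rightInverse
  let w : (Fin s.n → B) →L[Bᵐᵒᵖ] CompletedTensor θ F.E₁ :=
    finSum fun i => ctmul θ (s.w (Pi.single i 1)) 1
  have hw : ((cmap θ F.u).coprod w).comp (completedProdEquiv θ s.n).toContinuousLinearMap =
      cmap θ (F.u.coprod s.w) := CompletedTensor.hom_ext θ fun x b => by
    obtain ⟨x, a⟩ := x
    rw [ContinuousLinearMap.comp_apply, ContinuousLinearEquiv.coe_coe, completedProdEquiv_ctmul,
      cmap_ctmul, ContinuousLinearMap.coprod_apply, ContinuousLinearMap.coprod_apply, cmap_ctmul,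
      ctmul_add_left, finSum_apply]
    simp only [op_smul_ctmul, one_mul, ← ctmul_balanced]
    rw [← ctmul_sum_left]
    congr 2
    exact (linearMap_fin_apply s.w.toLinearMap a).symm
  have hs : Function.Surjective ((cmap θ F.u).coprod w) := by
    intro y
    refine ⟨completedProdEquiv θ s.n (cmap θ r y), ?_⟩
    have h1 := DFunLike.congr_fun hw (cmap θ r y)
    refine h1.trans ?_
    rw [← ContinuousLinearMap.comp_apply, ← cmap_comp, hr, cmap_id]
    rfl
  obtain ⟨t, ⟨e⟩, ht⟩ : ∃ t : (F.baseChange θ).Stabilization,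
      Nonempty (BaseChange θ.ringHom s.kernel ≃ₗ[Bᵐᵒᵖ] t.kernel) ∧
        K0.cls B (Fin t.n → B) = K0.cls B (Fin s.n → B) := by
    obtain ⟨m, V, W, hVW⟩ := exists_retract_of_isACompact_id s.isACompact_id_kernel
    refine ⟨⟨s.n, w, isACompact_of_fin w, hs⟩, ⟨?_⟩, rfl⟩
    exact (completedEquiv θ V W hVW).trans ((kerCmapEquiv θ _ r hr).trans
      (kerEquiv _ _ (completedProdEquiv θ s.n).toLinearEquiv fun x =>
        Iff.of_eq (congrArg (· = 0) (DFunLike.congr_fun hw x).symm)))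
  rw [index_eq s, index_eq t, map_sub, K0.map_cls, K0.map_cls, K0.cls_congr e, ht,
    K0.cls_congr (BaseChange.finEquiv θ.ringHom s.n)]

end FredholmModule

end

/-! ### Paths of idempotents and homotopy invariance of the index -/

section Idempotents

/-- The images of similar idempotents are isomorphic. -/
def similarEquiv {R : Type*} [Ring R] {N P Q : Type*} [AddCommGroup N] [Module R N]
    [AddCommGroup P] [Module R P] [AddCommGroup Q] [Module R Q] (i : P →ₗ[R] N) (p : N →ₗ[R] P)
    (hp : p ∘ₗ i = LinearMap.id) (j : Q →ₗ[R] N) (q : N →ₗ[R] Q) (hq : q ∘ₗ j = LinearMap.id)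
    (U V : N →ₗ[R] N) (hUV : U ∘ₗ V = LinearMap.id) (hVU : V ∘ₗ U = LinearMap.id)
    (h : U ∘ₗ (i ∘ₗ p) = (j ∘ₗ q) ∘ₗ U) : P ≃ₗ[R] Q :=
  have hp' : ∀ x, p (i x) = x := LinearMap.congr_fun hp
  have hq' : ∀ x, q (j x) = x := LinearMap.congr_fun hq
  have hU : ∀ x, U (V x) = x := LinearMap.congr_fun hUV
  have hV : ∀ x, V (U x) = x := LinearMap.congr_fun hVU
  have h' : ∀ x, U (i (p x)) = j (q (U x)) := LinearMap.congr_fun h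
  LinearEquiv.ofLinearMap (q ∘ₗ U ∘ₗ i) (p ∘ₗ V ∘ₗ j)
    (LinearMap.ext fun x => by
      simp only [LinearMap.comp_apply, LinearMap.id_apply]
      rw [h', hU, hq', hq'])
    (LinearMap.ext fun x => by
      simp only [LinearMap.comp_apply, LinearMap.id_apply]
      rw [← h', hV, hp', hp'])

/-- A matrix as a map of right modules. -/
def mulVecLinear {A : Type*} [Ring A] {n : ℕ} (M : Matrix (Fin n) (Fin n) A) :
    (Fin n → A) →ₗ[Aᵐᵒᵖ] (Fin n → A) where
  toFun := M.mulVec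
  map_add' := M.mulVec_add
  map_smul' a c := M.mulVec_smul a c

theorem mulVecLinear_mul {A : Type*} [Ring A] {n : ℕ} (M N : Matrix (Fin n) (Fin n) A) :
    mulVecLinear (M * N) = mulVecLinear M ∘ₗ mulVecLinear N :=
  LinearMap.ext fun c => (Matrix.mulVec_mulVec c M N).symm

theorem mulVecLinear_one {A : Type*} [Ring A] {n : ℕ} :
    mulVecLinear (1 : Matrix (Fin n) (Fin n) A) = LinearMap.id :=
  LinearMap.ext fun c => Matrix.one_mulVec c

open scoped Matrix.Norms.Operator in
-- Units are open in a complete normed ring; the operator norm makes matrices into one without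
-- changing the entrywise topology.
theorem isOpen_isUnit_matrix (A : Type u) [NormedRing A] [CompleteSpace A] (n : ℕ) :
    IsOpen {M : Matrix (Fin n) (Fin n) A | IsUnit M} := by
  have h : CompleteSpace (Matrix (Fin n) (Fin n) A) := inferInstance
  have : @CompleteSpace (Matrix (Fin n) (Fin n) A) PseudoMetricSpace.toUniformSpace := h
  exact Units.isOpen

end Idempotents

open FredholmModule in
-- A dual basis of `P` gives a continuous path of idempotent matrices `e t` whose images are the
-- fibres of `P`. The class of the fibre is locally constant by similarity of nearby idempotents,
-- hence constant on the connected interval.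
theorem K0.map_evalHom_eq (A : Type u) [NormedRing A] [NormedAlgebra ℂ A] [CompleteSpace A]
    (s t : unitInterval) : K0.map (evalHom A s).ringHom = K0.map (evalHom A t).ringHom := by
  refine K0.hom_ext fun P => ?_
  obtain ⟨n, x, f, hf⟩ := exists_dualBasis (A := C(unitInterval, A)) P.carrier
  let e : unitInterval → Matrix (Fin n) (Fin n) A := fun t => Matrix.of fun i j => f i (x j) t
  have he : Continuous e := by
    refine continuous_pi fun i => continuous_pi fun j => ?_
    exact (f i (x j)).continuous
  have hee : ∀ t, e t * e t = e t := by
    intro t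
    ext i j
    have h1 : f i (x j) = ∑ k, f i (x k) * f k (x j) := by
      conv_lhs => rw [← hf (x j), map_sum]
      simp
    rw [Matrix.mul_apply]
    simp only [e, Matrix.of_apply]
    conv_rhs => rw [h1]
    simp
  let i : ∀ t, BaseChange (evalHom A t).ringHom P.carrier →ₗ[Aᵐᵒᵖ] (Fin n → A) := fun t =>
    LinearMap.pi fun k => BaseChange.functional (evalHom A t).ringHom (f k)
  let p : ∀ t, (Fin n → A) →ₗ[Aᵐᵒᵖ] BaseChange (evalHom A t).ringHom P.carrier := fun t =>
    ∑ k, BaseChange.vector (evalHom A t).ringHom (x k) ∘ₗ LinearMap.proj k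
  have hpi : ∀ t, p t ∘ₗ i t = LinearMap.id := by
    intro t
    refine BaseChange.hom_ext _ fun y b => ?_
    have := BaseChange.sum_tmul (evalHom A t).ringHom hf y b
    simpa [p, i, BaseChange.functional_tmul, BaseChange.vector_apply] using this
  have hip : ∀ t, i t ∘ₗ p t = mulVecLinear (e t) := by
    intro t
    ext c k
    simp only [LinearMap.comp_apply, p, LinearMap.sum_apply, map_sum, i, LinearMap.pi_apply,
      BaseChange.vector_apply, BaseChange.functional_tmul, LinearMap.proj_apply]
    rfl
  have hloc : IsLocallyConstant fun t => K0.map (evalHom A t).ringHom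
      (K0.cls C(unitInterval, A) P.carrier) := by
    refine (IsLocallyConstant.iff_eventually_eq _).2 fun t => ?_
    -- This element equals `1` at `s = t`, so it is invertible nearby; multiplied by `e t` on the
    -- right or by `e s` on the left it gives `e s * e t`, so it conjugates `e t` into `e s`.
    have hcont : Continuous fun s => e s * e t + (1 - e s) * (1 - e t) := by fun_prop
    have hunit : ∀ᶠ s in nhds t, IsUnit (e s * e t + (1 - e s) * (1 - e t)) := by
      refine hcont.continuousAt.eventually ((isOpen_isUnit_matrix A n).mem_nhds ?_)
      have : e t * e t + (1 - e t) * (1 - e t) = 1 := by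
        simp [mul_sub, sub_mul, hee]
      change IsUnit (e t * e t + (1 - e t) * (1 - e t))
      rw [this]
      exact isUnit_one
    filter_upwards [hunit] with s hs
    obtain ⟨U, hU⟩ := hs
    have hcomm : U.val * e t = e s * U.val := by
      rw [hU]
      simp only [mul_add, add_mul, mul_sub, sub_mul, mul_one, one_mul, mul_assoc, hee]
      simp only [← mul_assoc, hee]
      abel
    rw [K0.map_cls, K0.map_cls]
    refine (K0.cls_congr (similarEquiv (i t) (p t) (hpi t) (i s) (p s) (hpi s)
      (mulVecLinear U.val) (mulVecLinear U.inv) ?_ ?_ ?_)).symm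
    · rw [← mulVecLinear_mul, U.val_inv, mulVecLinear_one]
    · rw [← mulVecLinear_mul, U.inv_val, mulVecLinear_one]
    · rw [hip, hip, ← mulVecLinear_mul, ← mulVecLinear_mul, hcomm]
  exact hloc.apply_eq_of_preconnectedSpace s t

theorem FredholmModule.Homotopic.index_eq {A : Type u} [NormedRing A] [NormedAlgebra ℂ A]
    [CompleteSpace A] {F G : FredholmModule A} (h : F.Homotopic G) : F.index = G.index := by
  obtain ⟨H, h0, h1⟩ := h
  rw [← h0.index_eq, ← h1.index_eq, index_baseChange, index_baseChange, K0.map_evalHom_eq A 0 1]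

/-! ### Morphisms up to compact perturbation, and stable equivalence -/

section

variable {A : Type u} [NormedRing A] [NormedAlgebra ℂ A] [CompleteSpace A]

section Intertwined

variable {M₀ M₁ N₀ N₁ L₀ L₁ X : Type u}
  [NormedAddCommGroup M₀] [NormedSpace ℂ M₀] [Module Aᵐᵒᵖ M₀] [IsScalarTower ℂ Aᵐᵒᵖ M₀]
  [NormedAddCommGroup M₁] [NormedSpace ℂ M₁] [Module Aᵐᵒᵖ M₁] [IsScalarTower ℂ Aᵐᵒᵖ M₁]
  [NormedAddCommGroup N₀] [NormedSpace ℂ N₀] [Module Aᵐᵒᵖ N₀] [IsScalarTower ℂ Aᵐᵒᵖ N₀]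
  [NormedAddCommGroup N₁] [NormedSpace ℂ N₁] [Module Aᵐᵒᵖ N₁] [IsScalarTower ℂ Aᵐᵒᵖ N₁]
  [NormedAddCommGroup L₀] [NormedSpace ℂ L₀] [Module Aᵐᵒᵖ L₀] [IsScalarTower ℂ Aᵐᵒᵖ L₀]
  [NormedAddCommGroup L₁] [NormedSpace ℂ L₁] [Module Aᵐᵒᵖ L₁] [IsScalarTower ℂ Aᵐᵒᵖ L₁]
  [NormedAddCommGroup X] [NormedSpace ℂ X] [Module Aᵐᵒᵖ X] [IsScalarTower ℂ Aᵐᵒᵖ X]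

/-- Two morphisms are isomorphic up to an `A`-compact morphism. -/
def Intertwined (f : M₀ →L[Aᵐᵒᵖ] M₁) (g : N₀ →L[Aᵐᵒᵖ] N₁) : Prop :=
  ∃ (e₀ : M₀ ≃L[Aᵐᵒᵖ] N₀) (e₁ : M₁ ≃L[Aᵐᵒᵖ] N₁),
    IsACompact (e₁.toContinuousLinearMap.comp f - g.comp e₀.toContinuousLinearMap)

variable {f : M₀ →L[Aᵐᵒᵖ] M₁} {g : N₀ →L[Aᵐᵒᵖ] N₁} {k : L₀ →L[Aᵐᵒᵖ] L₁}

theorem Intertwined.of_eq (e₀ : M₀ ≃L[Aᵐᵒᵖ] N₀) (e₁ : M₁ ≃L[Aᵐᵒᵖ] N₁)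
    (h : ∀ x, e₁ (f x) = g (e₀ x)) : Intertwined f g := by
  refine ⟨e₀, e₁, ?_⟩
  convert isACompact_zero (A := A) (E := M₀) (F := N₁) using 1
  ext x
  simp [h]

/-- Every morphism out of a module with compact identity is compact, so only the modules matter. -/
theorem Intertwined.of_isACompact_id (h : IsACompact (ContinuousLinearMap.id Aᵐᵒᵖ M₀))
    (e₀ : M₀ ≃L[Aᵐᵒᵖ] N₀) (e₁ : M₁ ≃L[Aᵐᵒᵖ] N₁) : Intertwined f g := by
  refine ⟨e₀, e₁, ?_⟩
  have := h.comp_left (e₁.toContinuousLinearMap.comp f - g.comp e₀.toContinuousLinearMap)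
  rwa [ContinuousLinearMap.comp_id] at this

theorem Intertwined.symm (h : Intertwined f g) : Intertwined g f := by
  obtain ⟨e₀, e₁, h⟩ := h
  refine ⟨e₀.symm, e₁.symm, ?_⟩
  convert ((h.comp_left e₁.symm.toContinuousLinearMap).comp_right
    e₀.symm.toContinuousLinearMap).neg using 1
  ext x
  simp

theorem Intertwined.trans (h : Intertwined f g) (h' : Intertwined g k) : Intertwined f k := by
  obtain ⟨e₀, e₁, h⟩ := h
  obtain ⟨d₀, d₁, h'⟩ := h'
  refine ⟨e₀.trans d₀, e₁.trans d₁, ?_⟩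
  convert (h.comp_left d₁.toContinuousLinearMap).add
    (h'.comp_right e₀.toContinuousLinearMap) using 1
  ext x
  simp

theorem Intertwined.prodMap_id (h : Intertwined f g) :
    Intertwined (f.prodMap (ContinuousLinearMap.id Aᵐᵒᵖ X))
      (g.prodMap (ContinuousLinearMap.id Aᵐᵒᵖ X)) := by
  obtain ⟨e₀, e₁, h⟩ := h
  refine ⟨e₀.prodCongr (ContinuousLinearEquiv.refl _ _),
    e₁.prodCongr (ContinuousLinearEquiv.refl _ _), ?_⟩
  convert (h.comp_left (ContinuousLinearMap.inl Aᵐᵒᵖ N₁ X)).comp_right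
    (ContinuousLinearMap.fst Aᵐᵒᵖ M₀ X) using 1
  ext x <;> simp

end Intertwined

/-- The rearrangement `M ⊕ (N ⊕ L) = L ⊕ (M ⊕ N)`. -/
def prodRotate (R M N L : Type*) [Semiring R] [AddCommMonoid M] [AddCommMonoid N]
    [AddCommMonoid L] [Module R M] [Module R N] [Module R L] : (M × N × L) ≃ₗ[R] (L × M × N) where
  toFun x := (x.2.2, x.1, x.2.1)
  map_add' _ _ := rfl
  map_smul' _ _ := rfl
  invFun x := (x.2.1, x.2.2, x.1)
  left_inv _ := rfl
  right_inv _ := rfl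

/-- The rearrangement `M ⊕ (N ⊕ L) = N ⊕ (M ⊕ L)`. -/
def prodSwapLeft (R M N L : Type*) [Semiring R] [AddCommMonoid M] [AddCommMonoid N]
    [AddCommMonoid L] [Module R M] [Module R N] [Module R L] : (M × N × L) ≃ₗ[R] (N × M × L) where
  toFun x := (x.2.1, x.1, x.2.2)
  map_add' _ _ := rfl
  map_smul' _ _ := rfl
  invFun x := (x.2.1, x.1, x.2.2)
  left_inv _ := rfl
  right_inv _ := rfl

/-- A finitely generated projective module is isomorphic to a Banach module. -/
theorem exists_banachModule (P : FGProj A) : ∃ E : BanachModule A,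
    IsACompact (ContinuousLinearMap.id Aᵐᵒᵖ E) ∧ Nonempty (P.carrier ≃ₗ[Aᵐᵒᵖ] E) := by
  obtain ⟨n, x, f, h⟩ := exists_dualBasis (A := A) P.carrier
  let i : P.carrier →ₗ[Aᵐᵒᵖ] (Fin n → A) := LinearMap.pi f
  let ε : (Fin n → A) →L[Aᵐᵒᵖ] (Fin n → A) := finSum fun j => i (x j)
  have hi : ∀ y, ε (i y) = i y := by
    intro y
    conv_rhs => rw [← h y]
    rw [finSum_apply, map_sum]
    simp [i]
  have hε : ∀ c, ε c = i (∑ j, op (c j) • x j) := by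
    intro c
    rw [finSum_apply, map_sum]
    simp
  -- The image of the idempotent `ε` is realized as the kernel of `1 - ε`: it is then closed in
  -- `A^n`, hence a Banach module.
  let d := ContinuousLinearMap.id Aᵐᵒᵖ (Fin n → A) - ε
  have hd : ∀ y, i y ∈ LinearMap.ker d.toLinearMap := by
    intro y
    change i y - ε (i y) = 0
    rw [hi, sub_self]
  refine ⟨⟨LinearMap.ker d.toLinearMap⟩, ?_, ⟨LinearEquiv.ofBijective (i.codRestrict _ hd) ?_⟩⟩
  · let p : (Fin n → A) →L[Aᵐᵒᵖ] LinearMap.ker d.toLinearMap :=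
      ε.codRestrict _ fun c => by rw [hε]; exact hd _
    have hp : p.comp (kerIncl d) = ContinuousLinearMap.id Aᵐᵒᵖ _ := by
      ext1 c
      have : c.1 - ε c.1 = 0 := c.2
      exact Subtype.ext (sub_eq_zero.1 this).symm
    have := (isACompact_of_fin p).comp_right (kerIncl d)
    rwa [hp] at this
  · constructor
    · intro y z hyz
      have hyz : i y = i z := congrArg Subtype.val hyz
      rw [← h y, ← h z]
      exact Finset.sum_congr rfl fun j _ => by rw [show f j y = f j z from congrFun hyz j]
    · intro c
      have hc : c.1 - ε c.1 = 0 := c.2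
      exact ⟨∑ j, op (c.1 j) • x j, Subtype.ext ((hε c.1).symm.trans (sub_eq_zero.1 hc).symm)⟩

namespace FredholmModule

/-- Fredholm modules that become isomorphic up to `A`-compact morphisms after the addition of
modules of the form `(X, X, 1, 1)`. -/
def StablyEquiv (F G : FredholmModule A) : Prop :=
  ∃ X Y : BanachModule A, Intertwined (F.u.prodMap (ContinuousLinearMap.id Aᵐᵒᵖ X))
    (G.u.prodMap (ContinuousLinearMap.id Aᵐᵒᵖ Y))

theorem StablyEquiv.symm {F G : FredholmModule A} (h : F.StablyEquiv G) : G.StablyEquiv F := by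
  obtain ⟨X, Y, h⟩ := h
  exact ⟨Y, X, h.symm⟩

theorem StablyEquiv.trans {F G H : FredholmModule A} (h : F.StablyEquiv G)
    (h' : G.StablyEquiv H) : F.StablyEquiv H := by
  obtain ⟨X, Y, h⟩ := h
  obtain ⟨X', Y', h'⟩ := h'
  -- The first equivalence is enlarged by `X'` and the second by `Y`, so that both pass through `G ⊕
  -- Y ⊕ X'`.
  refine ⟨⟨X × X'⟩, ⟨Y' × Y⟩, ?_⟩
  have h1 : Intertwined (F.u.prodMap (ContinuousLinearMap.id Aᵐᵒᵖ (X × X')))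
      ((F.u.prodMap (ContinuousLinearMap.id Aᵐᵒᵖ X)).prodMap (ContinuousLinearMap.id Aᵐᵒᵖ X')) :=
    .of_eq (ContinuousLinearEquiv.prodAssoc _ _ _ _).symm
      (ContinuousLinearEquiv.prodAssoc _ _ _ _).symm fun _ => rfl
  have h2 : Intertwined
      ((G.u.prodMap (ContinuousLinearMap.id Aᵐᵒᵖ Y)).prodMap (ContinuousLinearMap.id Aᵐᵒᵖ X'))
      ((G.u.prodMap (ContinuousLinearMap.id Aᵐᵒᵖ X')).prodMap
        (ContinuousLinearMap.id Aᵐᵒᵖ Y)) := by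
    let e (M : BanachModule A) : ((M × Y) × X') ≃L[Aᵐᵒᵖ] ((M × X') × Y) :=
      ContinuousLinearEquiv.equivOfInverse
        (((ContinuousLinearMap.fst Aᵐᵒᵖ _ _).prodMap (ContinuousLinearMap.id Aᵐᵒᵖ X')).prod
          ((ContinuousLinearMap.snd Aᵐᵒᵖ _ _).comp (ContinuousLinearMap.fst Aᵐᵒᵖ _ _)))
        (((ContinuousLinearMap.fst Aᵐᵒᵖ _ _).prodMap (ContinuousLinearMap.id Aᵐᵒᵖ Y)).prod
          ((ContinuousLinearMap.snd Aᵐᵒᵖ _ _).comp (ContinuousLinearMap.fst Aᵐᵒᵖ _ _)))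
        (fun _ => rfl) (fun _ => rfl)
    exact .of_eq (e G.E₀) (e G.E₁) fun _ => rfl
  have h3 : Intertwined
      ((H.u.prodMap (ContinuousLinearMap.id Aᵐᵒᵖ Y')).prodMap (ContinuousLinearMap.id Aᵐᵒᵖ Y))
      (H.u.prodMap (ContinuousLinearMap.id Aᵐᵒᵖ (Y' × Y))) :=
    .of_eq (ContinuousLinearEquiv.prodAssoc _ _ _ _)
      (ContinuousLinearEquiv.prodAssoc _ _ _ _) fun _ => rfl
  exact h1.trans (h.prodMap_id.trans (h2.trans (h'.prodMap_id.trans h3)))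

/-- The Fredholm module `(P, Q, 0, 0)`. -/
def ofZero (P Q : BanachModule A) (hP : IsACompact (ContinuousLinearMap.id Aᵐᵒᵖ P))
    (hQ : IsACompact (ContinuousLinearMap.id Aᵐᵒᵖ Q)) : FredholmModule A where
  E₀ := P
  E₁ := Q
  u := 0
  v := 0
  compact₀ := by simpa using hP.neg
  compact₁ := by simpa using hQ.neg

/-- A projection `W : A^m → Q` split by `V` stabilizes the zero map, and the splitting gives `P ⊕
A^m = ker (0, W) ⊕ Q`. -/
theorem index_ofZero (P Q : BanachModule A) (hP : IsACompact (ContinuousLinearMap.id Aᵐᵒᵖ P))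
    (hQ : IsACompact (ContinuousLinearMap.id Aᵐᵒᵖ Q)) [Module.Finite Aᵐᵒᵖ P]
    [Module.Projective Aᵐᵒᵖ P] [Module.Finite Aᵐᵒᵖ Q] [Module.Projective Aᵐᵒᵖ Q] :
    (ofZero P Q hP hQ).index = K0.cls A P - K0.cls A Q := by
  obtain ⟨m, V, W, hVW⟩ := exists_retract_of_isACompact_id hQ
  have hVW' : ∀ y, W (V y) = y := DFunLike.congr_fun hVW
  obtain ⟨s, ⟨e⟩, hs⟩ : ∃ s : (ofZero P Q hP hQ).Stabilization,
      Nonempty ((P × (Fin m → A)) ≃ₗ[Aᵐᵒᵖ] (s.kernel × Q)) ∧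
        K0.cls A (Fin s.n → A) = K0.cls A (Fin m → A) := by
    refine ⟨⟨m, W, isACompact_of_fin W, fun y => ⟨(0, V y), ?_⟩⟩, ⟨?_⟩, rfl⟩
    · change (0 : Q) + W (V y) = y
      exact (zero_add (W (V y))).trans (hVW' y)
    · exact (kerProdEquiv ((0 : P →L[Aᵐᵒᵖ] Q).coprod W)
        ((ContinuousLinearMap.inr Aᵐᵒᵖ _ _).comp V) (by
          ext y
          simp [hVW'])).toLinearEquiv
  have h := K0.cls_congr e
  rw [K0.cls_prod, K0.cls_prod] at h
  rw [index_eq s, sub_eq_sub_iff_add_eq_add, hs]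
  exact h.symm

/-- Under `E₀ ⊕ A^n = ker (u, w) ⊕ E₁` the second coordinate is `(u, w)` itself. So `u ⊕ 1` on the
left and `0 ⊕ 1` on the right differ only by terms that factor through `A^n`, which are compact. -/
theorem stablyEquiv_ofZero (F : FredholmModule A) (s : F.Stabilization) :
    F.StablyEquiv (ofZero ⟨s.kernel⟩ ⟨Fin s.n → A⟩ s.isACompact_id_kernel
      (isACompact_id_fin s.n)) := by
  obtain ⟨r, hr⟩ := s.exists_rightInverse
  have key : Intertwined (F.u.prodMap (ContinuousLinearMap.id Aᵐᵒᵖ (Fin s.n → A)))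
      ((0 : s.kernel →L[Aᵐᵒᵖ] (Fin s.n → A)).prodMap (ContinuousLinearMap.id Aᵐᵒᵖ F.E₁)) := by
    refine ⟨kerProdEquiv _ r hr, ContinuousLinearEquiv.prodComm _ _ _, ?_⟩
    convert! (isACompact_of_fin (ContinuousLinearMap.inl Aᵐᵒᵖ (Fin s.n → A) F.E₁ -
      (ContinuousLinearMap.inr Aᵐᵒᵖ (Fin s.n → A) F.E₁).comp s.w)).comp_right (ContinuousLinearMap.snd Aᵐᵒᵖ F.E₀ (Fin s.n → A)) using 1
    refine ContinuousLinearMap.ext fun x => ?_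
    change (x.2, F.u x.1) - ((0 : Fin s.n → A), F.u x.1 + s.w x.2) =
      (x.2, (0 : F.E₁)) - ((0 : Fin s.n → A), s.w x.2)
    ext <;> simp
  exact ⟨⟨Fin s.n → A⟩, F.E₁, key⟩

theorem stablyEquiv_of_cls_eq (P Q P' Q' : BanachModule A)
    (hP : IsACompact (ContinuousLinearMap.id Aᵐᵒᵖ P))
    (hQ : IsACompact (ContinuousLinearMap.id Aᵐᵒᵖ Q))
    (hP' : IsACompact (ContinuousLinearMap.id Aᵐᵒᵖ P'))
    (hQ' : IsACompact (ContinuousLinearMap.id Aᵐᵒᵖ Q')) [Module.Finite Aᵐᵒᵖ P]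
    [Module.Projective Aᵐᵒᵖ P] [Module.Finite Aᵐᵒᵖ Q] [Module.Projective Aᵐᵒᵖ Q]
    [Module.Finite Aᵐᵒᵖ P'] [Module.Projective Aᵐᵒᵖ P'] [Module.Finite Aᵐᵒᵖ Q']
    [Module.Projective Aᵐᵒᵖ Q']
    (h : K0.cls A P - K0.cls A Q = K0.cls A P' - K0.cls A Q') :
    (ofZero P Q hP hQ).StablyEquiv (ofZero P' Q' hP' hQ') := by
  rw [sub_eq_sub_iff_add_eq_add, ← K0.cls_prod, ← K0.cls_prod, K0.cls_eq_iff] at h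
  obtain ⟨R, ⟨e⟩⟩ := h
  obtain ⟨E, hE, ⟨d⟩⟩ := exists_banachModule R
  -- The stabilizing module `R`, in its Banach form `E`, joins the degenerate summands `Q' ⊕ E` and
  -- `Q ⊕ E`. The equality of classes gives the isomorphism in even degree; in odd degree a
  -- permutation suffices.
  let e₀ : (P × Q' × E) ≃ₗ[Aᵐᵒᵖ] (P' × Q × E) :=
    (prodRotate _ _ _ _).trans ((LinearEquiv.prodCongr d.symm (LinearEquiv.refl _ _)).trans
      (e.trans ((LinearEquiv.prodCongr d (LinearEquiv.refl _ _)).trans (prodRotate _ _ _ _).symm)))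
  have h0 := isACompact_id_prod hP (isACompact_id_prod hQ' hE)
  have key : Intertwined ((0 : P →L[Aᵐᵒᵖ] Q).prodMap (ContinuousLinearMap.id Aᵐᵒᵖ (Q' × E)))
      ((0 : P' →L[Aᵐᵒᵖ] Q').prodMap (ContinuousLinearMap.id Aᵐᵒᵖ (Q × E))) :=
    .of_isACompact_id h0
      (continuousEquiv h0 (isACompact_id_prod hP' (isACompact_id_prod hQ hE)) e₀)
      (continuousEquiv (isACompact_id_prod hQ (isACompact_id_prod hQ' hE))
        (isACompact_id_prod hQ' (isACompact_id_prod hQ hE)) (prodSwapLeft _ _ _ _))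
  exact ⟨⟨Q' × E⟩, ⟨Q × E⟩, key⟩

theorem stablyEquiv_of_index_eq {F G : FredholmModule A} (h : F.index = G.index) :
    F.StablyEquiv G := by
  let s := F.nonempty_stabilization.some
  let t := G.nonempty_stabilization.some
  rw [index_eq s, index_eq t] at h
  exact (F.stablyEquiv_ofZero s).trans ((stablyEquiv_of_cls_eq ⟨s.kernel⟩ ⟨Fin s.n → A⟩
    ⟨t.kernel⟩ ⟨Fin t.n → A⟩ _ _ _ _ h).trans (G.stablyEquiv_ofZero t).symm)

end FredholmModule

end

/-! ### Modules of paths over `A[0,1]` -/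

section PathModules

variable {A : Type u} [NormedRing A] [NormedAlgebra ℂ A]

/-- The morphism `A → E`, `a ↦ x a`. -/
def vectorMorphism {E : Type u} [NormedAddCommGroup E] [Module Aᵐᵒᵖ E] [IsBoundedSMul Aᵐᵒᵖ E]
    (x : E) : A →L[Aᵐᵒᵖ] E where
  toFun a := op a • x
  map_add' a b := by simp [add_smul]
  map_smul' a b := by
    induction a
    simp [mul_smul]
  cont := by
    have : Continuous (op : A → Aᵐᵒᵖ) := continuous_op
    change Continuous fun a : A => op a • x
    fun_prop

variable {M L M' : Type u}
  [NormedAddCommGroup M] [NormedSpace ℂ M] [Module Aᵐᵒᵖ M] [IsScalarTower ℂ Aᵐᵒᵖ M]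
  [IsBoundedSMul Aᵐᵒᵖ M]
  [NormedAddCommGroup L] [NormedSpace ℂ L] [Module Aᵐᵒᵖ L] [IsScalarTower ℂ Aᵐᵒᵖ L]
  [IsBoundedSMul Aᵐᵒᵖ L]
  [NormedAddCommGroup M'] [NormedSpace ℂ M'] [Module Aᵐᵒᵖ M'] [IsScalarTower ℂ Aᵐᵒᵖ M']
  [IsBoundedSMul Aᵐᵒᵖ M']

/-- The continuous paths in `M` with values in a family of submodules. -/
def pathSubmodule (N : unitInterval → Submodule Aᵐᵒᵖ M) : Submodule ℂ C(unitInterval, M) where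
  carrier := {f | ∀ t, f t ∈ N t}
  add_mem' hf hg t := (N t).add_mem (hf t) (hg t)
  zero_mem' t := (N t).zero_mem
  smul_mem' c _ hf t := (N t).smul_of_tower_mem c (hf t)

/-- Paths with values in a family of submodules. -/
abbrev PathModule (N : unitInterval → Submodule Aᵐᵒᵖ M) : Type u := pathSubmodule N

variable {N : unitInterval → Submodule Aᵐᵒᵖ M} {N' : unitInterval → Submodule Aᵐᵒᵖ M'}

instance : SMul C(unitInterval, A)ᵐᵒᵖ (PathModule N) where
  smul a f := ⟨⟨fun t => op (unop a t) • f.1 t, by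
    have : Continuous (op : A → Aᵐᵒᵖ) := continuous_op
    fun_prop⟩, fun t => (N t).smul_mem _ (f.2 t)⟩

theorem PathModule.smul_apply (a : C(unitInterval, A)ᵐᵒᵖ) (f : PathModule N) (t : unitInterval) :
    (a • f).1 t = op (unop a t) • f.1 t := rfl

theorem PathModule.ext {f g : PathModule N} (h : ∀ t, f.1 t = g.1 t) : f = g :=
  Subtype.ext (ContinuousMap.ext h)

instance : Module C(unitInterval, A)ᵐᵒᵖ (PathModule N) where
  one_smul _ := PathModule.ext fun _ => one_smul _ _
  mul_smul a b _ := PathModule.ext fun t => mul_smul (op (unop a t)) (op (unop b t)) _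
  smul_zero _ := PathModule.ext fun _ => smul_zero _
  smul_add _ _ _ := PathModule.ext fun _ => smul_add _ _ _
  add_smul a b _ := PathModule.ext fun t => add_smul (op (unop a t)) (op (unop b t)) _
  zero_smul _ := PathModule.ext fun _ => zero_smul _ _

instance : IsScalarTower ℂ C(unitInterval, A)ᵐᵒᵖ (PathModule N) where
  smul_assoc c a f := PathModule.ext fun t => smul_assoc c (op (unop a t)) (f.1 t)

theorem PathModule.norm_apply_le (f : PathModule N) (t : unitInterval) : ‖f.1 t‖ ≤ ‖f‖ :=
  f.1.norm_coe_le_norm t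

theorem PathModule.norm_le {f : PathModule N} {C : ℝ} (hC : 0 ≤ C) (h : ∀ t, ‖f.1 t‖ ≤ C) :
    ‖f‖ ≤ C :=
  (ContinuousMap.norm_le f.1 hC).2 h

instance : IsBoundedSMul C(unitInterval, A)ᵐᵒᵖ (PathModule N) :=
  IsBoundedSMul.of_norm_smul_le fun a f => PathModule.norm_le (by positivity) fun t => by
    rw [PathModule.smul_apply]
    refine (norm_smul_le _ _).trans ?_
    gcongr
    · exact (unop a).norm_coe_le_norm t
    · exact f.norm_apply_le t

theorem completeSpace_pathModule [CompleteSpace M] (hN : ∀ t, IsClosed (N t : Set M)) :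
    CompleteSpace (PathModule N) := by
  have : IsClosed (pathSubmodule N : Set C(unitInterval, M)) := by
    have h : (pathSubmodule N : Set C(unitInterval, M)) =
        ⋂ t, (fun f : C(unitInterval, M) => f t) ⁻¹' (N t) := by
      ext f
      simp [pathSubmodule]
    rw [h]
    exact isClosed_iInter fun t => (hN t).preimage (continuous_eval_const t)
  exact this.completeSpace_coe

/-- The morphism `f ↦ a k(f)` of path modules. -/
def pathMap (a : C(unitInterval, ℂ)) (k : M →L[Aᵐᵒᵖ] M')
    (h : ∀ t, ∀ x ∈ N t, a t • k x ∈ N' t) :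
    PathModule N →L[C(unitInterval, A)ᵐᵒᵖ] PathModule N' :=
  let g : PathModule N →ₗ[C(unitInterval, A)ᵐᵒᵖ] PathModule N' :=
    { toFun := fun f => ⟨⟨fun t => a t • k (f.1 t), by fun_prop⟩, fun t => h t _ (f.2 t)⟩
      map_add' := fun f g => PathModule.ext fun t => by
        change a t • k (f.1 t + g.1 t) = a t • k (f.1 t) + a t • k (g.1 t)
        rw [map_add, smul_add]
      map_smul' := fun b f => PathModule.ext fun t => by
        have := IsScalarTower.to_smulCommClass (R := ℂ) (A := Aᵐᵒᵖ) (M := M')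
        change a t • k (op (unop b t) • f.1 t) = op (unop b t) • a t • k (f.1 t)
        rw [map_smul, smul_comm] }
  { g with
    cont := AddMonoidHomClass.continuous_of_bound g (‖a‖ * ‖k.restrictScalars ℂ‖) fun f =>
      PathModule.norm_le (by positivity) fun t => by
        change ‖a t • k (f.1 t)‖ ≤ _
        rw [norm_smul, mul_assoc]
        gcongr
        · exact a.norm_coe_le_norm t
        · refine (norm_le_of_morphism k _).trans ?_
          gcongr
          exact f.norm_apply_le t }

/-- Composition with a continuous functional. -/
def pathFunctional (v : M →L[Aᵐᵒᵖ] A) :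
    PathModule N →L[C(unitInterval, A)ᵐᵒᵖ] C(unitInterval, A) :=
  let g : PathModule N →ₗ[C(unitInterval, A)ᵐᵒᵖ] C(unitInterval, A) :=
    { toFun := fun f => ⟨fun t => v (f.1 t), by fun_prop⟩
      map_add' := fun f g => ContinuousMap.ext fun t => map_add v (f.1 t) (g.1 t)
      map_smul' := fun b f => ContinuousMap.ext fun t => map_smul v (op (unop b t)) (f.1 t) }
  { g with
    cont := AddMonoidHomClass.continuous_of_bound g ‖v.restrictScalars ℂ‖ fun f =>
      (ContinuousMap.norm_le _ (by positivity)).2 fun t => by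
        refine (norm_le_of_morphism v _).trans ?_
        gcongr
        exact f.norm_apply_le t }

/-- `κ ↦ (f ↦ a j(κ(f)))` as a continuous linear map of `κ`. -/
def pathLift (a : C(unitInterval, ℂ)) (j : L →L[Aᵐᵒᵖ] M') (h : ∀ t y, a t • j y ∈ N' t) :
    (M →L[ℂ] L) →L[ℂ] PathModule N →L[ℂ] PathModule N' :=
  LinearMap.mkContinuous₂
    (LinearMap.mk₂ ℂ
      (fun (κ : M →L[ℂ] L) (f : PathModule N) => (⟨⟨fun t => a t • j.restrictScalars ℂ (κ (f.1 t)), by fun_prop⟩,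
        fun t => h t _⟩ : PathModule N'))
      (fun κ κ' f => PathModule.ext fun t => by simp)
      (fun c κ f => PathModule.ext fun t => by
        change a t • j.restrictScalars ℂ (c • κ (f.1 t)) = c • a t • j.restrictScalars ℂ (κ (f.1 t))
        rw [map_smul, smul_comm])
      (fun κ f g => PathModule.ext fun t => by
        change a t • j.restrictScalars ℂ (κ (f.1 t + g.1 t)) =
          a t • j.restrictScalars ℂ (κ (f.1 t)) + a t • j.restrictScalars ℂ (κ (g.1 t))
        rw [map_add, map_add, smul_add])
      (fun c κ f => PathModule.ext fun t => by
        change a t • j.restrictScalars ℂ (κ (c • f.1 t)) = c • a t • j.restrictScalars ℂ (κ (f.1 t))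
        rw [map_smul, map_smul, smul_comm]))
    (‖a‖ * ‖j.restrictScalars ℂ‖) (fun κ f => PathModule.norm_le (by positivity) fun t => by
      change ‖a t • j.restrictScalars ℂ (κ (f.1 t))‖ ≤ _
      rw [norm_smul, mul_assoc, mul_assoc]
      gcongr
      · exact a.norm_coe_le_norm t
      · refine ((j.restrictScalars ℂ).le_opNorm _).trans ?_
        gcongr
        refine (κ.le_opNorm _).trans ?_
        gcongr
        exact f.norm_apply_le t)

theorem isClosed_compactMorphisms :
    IsClosed (compactMorphisms A M L : Set (M →L[ℂ] L)) :=
  Submodule.isClosed_topologicalClosure _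

/-- The operator depends continuously and linearly on `k`, so rank one `k = w v` suffices. It then
factors through `A[0,1]` by `f ↦ v ∘ f` and the path `t ↦ a(t) j(w 1)`. Requiring `a j` to land in
the family on all of `L` keeps the approximating operators inside the path module. -/
theorem isACompact_pathMap (a : C(unitInterval, ℂ)) {k : M →L[Aᵐᵒᵖ] L} (hk : IsACompact k)
    (j : L →L[Aᵐᵒᵖ] M') (h : ∀ t y, a t • j y ∈ N' t) :
    IsACompact (pathMap (N := N) (N' := N') a (j.comp k) fun t _ _ => h t _) := by
  have hcl : IsClosed (compactMorphisms C(unitInterval, A) (PathModule N) (PathModule N') :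
      Set (PathModule N →L[ℂ] PathModule N')) :=
    isClosed_compactMorphisms (A := C(unitInterval, A)) (M := PathModule N) (L := PathModule N')
  have hle : compactMorphisms A M L ≤
      (compactMorphisms C(unitInterval, A) (PathModule N) (PathModule N')).comap
        (pathLift (N := N) a j h).toLinearMap := by
    refine Submodule.topologicalClosure_minimal _ (Submodule.span_le.2 ?_)
      (hcl.preimage (pathLift a j h).continuous)
    rintro _ ⟨v, w, rfl⟩
    have hmem : IsACompact ((vectorMorphism (⟨⟨fun t => a t • j (w 1), by fun_prop⟩,
        fun t => h t _⟩ : PathModule N')).comp (pathFunctional (N := N) v)) := isACompact_comp _ _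
    have heq : pathLift (N := N) a j h ((w.comp v).restrictScalars ℂ) =
        ((vectorMorphism (⟨⟨fun t => a t • j (w 1), by fun_prop⟩, fun t => h t _⟩ :
          PathModule N')).comp (pathFunctional (N := N) v)).restrictScalars ℂ := by
      ext f t
      have := IsScalarTower.to_smulCommClass (R := ℂ) (A := Aᵐᵒᵖ) (M := M')
      change a t • j (w (v (f.1 t))) = op (v (f.1 t)) • a t • j (w 1)
      have h1 : w (v (f.1 t)) = op (v (f.1 t)) • w 1 := by rw [← map_smul]; simp
      rw [h1, map_smul, smul_comm]
    unfold IsACompact at hmem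
    rw [← heq] at hmem
    exact hmem
  exact hle hk

end PathModules

/-! ### Fibres of path modules -/

section Fibres

open FredholmModule

variable {A : Type u} [NormedRing A] [NormedAlgebra ℂ A] [CompleteSpace A]
variable {M L : Type u}
  [NormedAddCommGroup M] [NormedSpace ℂ M] [Module Aᵐᵒᵖ M] [IsScalarTower ℂ Aᵐᵒᵖ M]
  [IsBoundedSMul Aᵐᵒᵖ M]
  [NormedAddCommGroup L] [NormedSpace ℂ L] [Module Aᵐᵒᵖ L] [IsScalarTower ℂ Aᵐᵒᵖ L]
  [IsBoundedSMul Aᵐᵒᵖ L] [CompleteSpace L]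
  {N : unitInterval → Submodule Aᵐᵒᵖ M}

/-- Paths that vanish at `s` vanish in the fibre at `s`. -/
theorem ctmul_eq_zero_of_apply_eq_zero {s : unitInterval} {f : PathModule N} (hf : f.1 s = 0)
    (b : A) : ctmul (evalHom A s) f b = 0 := by
  have key : ∀ ε : ℝ, 0 < ε → ‖ctmul (evalHom A s) f b‖ ≤ ε * ‖b‖ := by
    intro ε hε
    have hpos : ∀ t, 0 < ‖f.1 t‖ + ε := fun t => by positivity
    -- The scalar `‖f‖ / (‖f‖ + ε)` vanishes at `s`, so `h f` dies in the fibre, while `f - h f` has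
    -- norm at most `ε`.
    let h : C(unitInterval, A) :=
      ⟨fun t => ((‖f.1 t‖ / (‖f.1 t‖ + ε) : ℝ) : ℂ) • (1 : A), by
        have h1 : Continuous fun t => ‖f.1 t‖ / (‖f.1 t‖ + ε) :=
          Continuous.div (by fun_prop) (by fun_prop) fun t => (hpos t).ne'
        exact (Complex.continuous_ofReal.comp h1).smul continuous_const⟩
    have h0 : ctmul (evalHom A s) (op h • f) b = 0 := by
      have hs : (evalHom A s).ringHom h = 0 := by
        change ((‖f.1 s‖ / (‖f.1 s‖ + ε) : ℝ) : ℂ) • (1 : A) = 0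
        simp [hf]
      rw [ctmul_balanced, hs, zero_mul]
      have := ctmul_add_right (evalHom A s) f 0 0
      simpa using this
    have h1 : ctmul (evalHom A s) f b = ctmul (evalHom A s) (f - op h • f) b := by
      have := ctmul_add_left (evalHom A s) (f - op h • f) (op h • f) b
      rwa [sub_add_cancel, h0, add_zero] at this
    rw [h1]
    refine (norm_ctmul_le _ _ _).trans ?_
    gcongr
    refine PathModule.norm_le hε.le fun t => ?_
    have h2 : (f - op h • f).1 t = ((1 - ‖f.1 t‖ / (‖f.1 t‖ + ε) : ℝ) : ℂ) • f.1 t := by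
      change f.1 t - op (((‖f.1 t‖ / (‖f.1 t‖ + ε) : ℝ) : ℂ) • (1 : A)) • f.1 t = _
      rw [op_smul, op_one, smul_assoc, one_smul, Complex.ofReal_sub, Complex.ofReal_one, sub_smul,
        one_smul]
    have h3 : 1 - ‖f.1 t‖ / (‖f.1 t‖ + ε) = ε / (‖f.1 t‖ + ε) := by
      have := (hpos t).ne'
      field_simp
      ring
    rw [h2, h3, norm_smul, Complex.norm_real, Real.norm_of_nonneg (by positivity), div_mul_eq_mul_div,
      div_le_iff₀ (hpos t)]
    gcongr
    linarith
  by_contra hne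
  have h1 : 0 < ‖ctmul (evalHom A s) f b‖ := norm_pos_iff.2 hne
  -- This `ε` would bound the positive norm by less than half of itself; the `+ 1` covers `b = 0`.
  have h2 := key (‖ctmul (evalHom A s) f b‖ / (2 * (‖b‖ + 1))) (by positivity)
  rw [div_mul_eq_mul_div, le_div_iff₀ (by positivity)] at h2
  nlinarith [norm_nonneg b]

/-- The map from the fibre at `s` induced by `ρ : M → L`. -/
def fibreMap (N : unitInterval → Submodule Aᵐᵒᵖ M) (s : unitInterval) (ρ : M →L[Aᵐᵒᵖ] L) :
    CompletedTensor (evalHom A s) (PathModule N) →L[Aᵐᵒᵖ] L :=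
  (PreTensor.liftCLM (evalHom A s).ringHom
    (AddMonoidHom.mk' (fun f : PathModule N => ρ (f.1 s)) fun f g => map_add ρ (f.1 s) (g.1 s))
    (fun a f => map_smul ρ (op (a s)) (f.1 s)) ‖ρ.restrictScalars ℂ‖ (norm_nonneg _) (by
      intro f b
      refine (norm_smul_le _ _).trans ?_
      rw [norm_op, mul_comm, ← mul_assoc]
      gcongr
      refine (norm_le_of_morphism ρ _).trans ?_
      gcongr
      exact f.norm_apply_le s)).fromCompletion

theorem fibreMap_ctmul (s : unitInterval) (ρ : M →L[Aᵐᵒᵖ] L) (f : PathModule N) (b : A) :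
    fibreMap N s ρ (ctmul (evalHom A s) f b) = op b • ρ (f.1 s) := by
  rw [fibreMap, ctmul]
  exact ContinuousLinearMap.fromCompletion_apply_coe _ _

/-- The path `t ↦ φ(t) ι(y)`. -/
def pathSection (φ : C(unitInterval, ℂ)) (ι : L →L[Aᵐᵒᵖ] M) (h : ∀ t y, φ t • ι y ∈ N t) (y : L) :
    PathModule N :=
  ⟨⟨fun t => φ t • ι y, by fun_prop⟩, fun t => h t y⟩

theorem pathSection_apply (φ : C(unitInterval, ℂ)) (ι : L →L[Aᵐᵒᵖ] M)
    (h : ∀ t y, φ t • ι y ∈ N t) (y : L) (t : unitInterval) :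
    (pathSection φ ι h y).1 t = φ t • ι y := rfl

/-- The map `y ↦ (φ ι(y)) ⊗ 1` to the fibre at `s`. -/
def fibreSection (s : unitInterval) (φ : C(unitInterval, ℂ)) (ι : L →L[Aᵐᵒᵖ] M)
    (h : ∀ t y, φ t • ι y ∈ N t) : L →L[Aᵐᵒᵖ] CompletedTensor (evalHom A s) (PathModule N) :=
  let g : L →ₗ[Aᵐᵒᵖ] CompletedTensor (evalHom A s) (PathModule N) :=
    { toFun := fun y => ctmul (evalHom A s) (pathSection φ ι h y) 1
      map_add' := fun y z => by
        rw [← ctmul_add_left]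
        congr 1
        refine PathModule.ext fun t => ?_
        change φ t • ι (y + z) = φ t • ι y + φ t • ι z
        rw [map_add, smul_add]
      map_smul' := fun a y => by
        have hs : pathSection φ ι h (a • y) =
            op (ContinuousMap.const unitInterval (unop a)) • pathSection φ ι h y := by
          have := IsScalarTower.to_smulCommClass (R := ℂ) (A := Aᵐᵒᵖ) (M := M)
          refine PathModule.ext fun t => ?_
          change φ t • ι (a • y) = a • φ t • ι y
          rw [map_smul, smul_comm]
        rw [hs, ctmul_balanced, RingHom.id_apply]
        conv_rhs => rw [← op_unop a, op_smul_ctmul, one_mul]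
        rw [mul_one]
        rfl }
  { g with
    -- The factor `‖1‖` is kept because the norm of the unit is not assumed to be `1`.
    cont := AddMonoidHomClass.continuous_of_bound g (‖φ‖ * ‖ι.restrictScalars ℂ‖ * ‖(1 : A)‖)
      fun y => by
        refine (norm_ctmul_le _ _ _).trans ?_
        rw [mul_right_comm]
        gcongr
        refine PathModule.norm_le (by positivity) fun t => ?_
        rw [pathSection_apply, norm_smul, mul_assoc]
        gcongr
        · exact φ.norm_coe_le_norm t
        · exact norm_le_of_morphism ι y }

theorem fibreSection_apply (s : unitInterval) (φ : C(unitInterval, ℂ)) (ι : L →L[Aᵐᵒᵖ] M)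
    (h : ∀ t y, φ t • ι y ∈ N t) (y : L) :
    fibreSection s φ ι h y = ctmul (evalHom A s) (pathSection φ ι h y) 1 := rfl

/-- The fibre at `s` of a path module. -/
def fibreEquiv (s : unitInterval) (ι : L →L[Aᵐᵒᵖ] M) (ρ : M →L[Aᵐᵒᵖ] L)
    (hρι : ∀ y, ρ (ι y) = y) (hN : ∀ x ∈ N s, ι (ρ x) = x) (φ : C(unitInterval, ℂ))
    (hφ : φ s = 1) (h : ∀ t y, φ t • ι y ∈ N t) :
    CompletedTensor (evalHom A s) (PathModule N) ≃L[Aᵐᵒᵖ] L :=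
  ContinuousLinearEquiv.equivOfInverse (fibreMap N s ρ) (fibreSection s φ ι h)
    (DFunLike.congr_fun (f := (fibreSection s φ ι h).comp (fibreMap N s ρ))
      (g := ContinuousLinearMap.id Aᵐᵒᵖ _) (CompletedTensor.hom_ext _ fun f b => by
        rw [ContinuousLinearMap.comp_apply, fibreMap_ctmul, map_smul, fibreSection_apply,
          op_smul_ctmul, one_mul, ContinuousLinearMap.id_apply]
        -- As `φ s = 1`, the section through `f s` differs from `f` by a path that vanishes at `s`,
        -- so both have the same class in the fibre.
        have h0 : ctmul (evalHom A s) (f - pathSection φ ι h (ρ (f.1 s))) b = 0 := by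
          refine ctmul_eq_zero_of_apply_eq_zero ?_ b
          change f.1 s - φ s • ι (ρ (f.1 s)) = 0
          rw [hφ, one_smul, hN _ (f.2 s), sub_self]
        have h1 := ctmul_add_left (evalHom A s) (f - pathSection φ ι h (ρ (f.1 s)))
          (pathSection φ ι h (ρ (f.1 s))) b
        rw [sub_add_cancel, h0, zero_add] at h1
        exact h1.symm))
    (fun y => by
      rw [fibreSection_apply, fibreMap_ctmul, op_one, one_smul, pathSection_apply, hφ, one_smul,
        hρι])

end Fibres

/-! ### The homotopy between two corners of the same module -/

namespace FredholmModule

variable {A : Type u} [NormedRing A] [NormedAlgebra ℂ A]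

/-- The Fredholm module with the opposite grading. -/
def swap (F : FredholmModule A) : FredholmModule A := ⟨F.E₁, F.E₀, F.v, F.u, F.compact₁, F.compact₀⟩

/-- A realization of a Fredholm module `F` as a direct summand of morphisms `u : M₀ → M₁` and
`v : M₁ → M₀` that are inverse to each other on the complement. -/
structure Corner (F : FredholmModule A) (M₀ M₁ : BanachModule A) where
  u : M₀ →L[Aᵐᵒᵖ] M₁
  v : M₁ →L[Aᵐᵒᵖ] M₀
  ι₀ : F.E₀ →L[Aᵐᵒᵖ] M₀
  ρ₀ : M₀ →L[Aᵐᵒᵖ] F.E₀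
  ι₁ : F.E₁ →L[Aᵐᵒᵖ] M₁
  ρ₁ : M₁ →L[Aᵐᵒᵖ] F.E₁
  ρ₀_ι₀ : ∀ x, ρ₀ (ι₀ x) = x
  ρ₁_ι₁ : ∀ y, ρ₁ (ι₁ y) = y
  u_ι₀ : ∀ x, u (ι₀ x) = ι₁ (F.u x)
  v_ι₁ : ∀ y, v (ι₁ y) = ι₀ (F.v y)
  v_u : ∀ x, v (u x) - x = ι₀ (F.v (F.u (ρ₀ x)) - ρ₀ x)
  u_v : ∀ y, u (v y) - y = ι₁ (F.u (F.v (ρ₁ y)) - ρ₁ y)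

namespace Corner

variable {F G : FredholmModule A} {M₀ M₁ N₀ N₁ : BanachModule A}

/-- The corner with the opposite grading. -/
def swap (c : Corner F M₀ M₁) : Corner F.swap M₁ M₀ :=
  ⟨c.v, c.u, c.ι₁, c.ρ₁, c.ι₀, c.ρ₀, c.ρ₁_ι₁, c.ρ₀_ι₀, c.v_ι₁, c.u_ι₀, c.u_v, c.v_u⟩

/-- The corner `F` of `F ⊕ (X, X, 1, 1)`. -/
def stabilize (F : FredholmModule A) (X : BanachModule A) : Corner F ⟨F.E₀ × X⟩ ⟨F.E₁ × X⟩ where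
  u := F.u.prodMap (ContinuousLinearMap.id Aᵐᵒᵖ X)
  v := F.v.prodMap (ContinuousLinearMap.id Aᵐᵒᵖ X)
  ι₀ := ContinuousLinearMap.inl Aᵐᵒᵖ F.E₀ X
  ρ₀ := ContinuousLinearMap.fst Aᵐᵒᵖ F.E₀ X
  ι₁ := ContinuousLinearMap.inl Aᵐᵒᵖ F.E₁ X
  ρ₁ := ContinuousLinearMap.fst Aᵐᵒᵖ F.E₁ X
  ρ₀_ι₀ _ := rfl
  ρ₁_ι₁ _ := rfl
  u_ι₀ _ := rfl
  v_ι₁ _ := rfl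
  v_u x := Prod.ext rfl (sub_self x.2)
  u_v y := Prod.ext rfl (sub_self y.2)

/-- Transport of a corner along isomorphisms. -/
def transport (c : Corner F M₀ M₁) (e₀ : N₀ ≃L[Aᵐᵒᵖ] M₀) (e₁ : N₁ ≃L[Aᵐᵒᵖ] M₁) :
    Corner F N₀ N₁ where
  u := e₁.symm.toContinuousLinearMap.comp (c.u.comp e₀.toContinuousLinearMap)
  v := e₀.symm.toContinuousLinearMap.comp (c.v.comp e₁.toContinuousLinearMap)
  ι₀ := e₀.symm.toContinuousLinearMap.comp c.ι₀
  ρ₀ := c.ρ₀.comp e₀.toContinuousLinearMap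
  ι₁ := e₁.symm.toContinuousLinearMap.comp c.ι₁
  ρ₁ := c.ρ₁.comp e₁.toContinuousLinearMap
  ρ₀_ι₀ x := by simp [c.ρ₀_ι₀]
  ρ₁_ι₁ x := by simp [c.ρ₁_ι₁]
  u_ι₀ x := by simp [c.u_ι₀]
  v_ι₁ x := by simp [c.v_ι₁]
  v_u x := by
    apply e₀.injective
    have := c.v_u (e₀ x)
    simpa using this
  u_v x := by
    apply e₁.injective
    have := c.u_v (e₁ x)
    simpa using this

/-- The submodule `F.E₀` of `M₀`. -/
def range₀ (c : Corner F M₀ M₁) : Submodule Aᵐᵒᵖ M₀ :=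
  LinearMap.ker (c.ι₀.comp c.ρ₀ - ContinuousLinearMap.id Aᵐᵒᵖ M₀).toLinearMap

theorem mem_range₀ (c : Corner F M₀ M₁) {x : M₀} : x ∈ c.range₀ ↔ c.ι₀ (c.ρ₀ x) = x :=
  sub_eq_zero

theorem isClosed_range₀ (c : Corner F M₀ M₁) : IsClosed (c.range₀ : Set M₀) :=
  ContinuousLinearMap.isClosed_ker _

theorem ι₀_mem (c : Corner F M₀ M₁) (x : F.E₀) : c.ι₀ x ∈ c.range₀ := by
  rw [mem_range₀, c.ρ₀_ι₀]

theorem u_mem (c : Corner F M₀ M₁) {x : M₀} (hx : x ∈ c.range₀) : c.u x ∈ c.swap.range₀ := by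
  rw [← c.mem_range₀.1 hx, c.u_ι₀]
  exact c.swap.ι₀_mem _

theorem isACompact_v_u (c : Corner F M₀ M₁) :
    IsACompact (c.v.comp c.u - ContinuousLinearMap.id Aᵐᵒᵖ M₀) := by
  convert! (F.compact₀.comp_left c.ι₀).comp_right c.ρ₀ using 1
  ext x
  simpa using c.v_u x

/-- Parametrices of morphisms that agree modulo compacts agree modulo compacts: with `u, v` from `c`
and `u', v'` from `d`, `v - v' = (vu - 1)v' - v(u'v' - 1) - v(u - u')v'`. -/
theorem isACompact_v_sub (c : Corner F M₀ M₁) (d : Corner G M₀ M₁)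
    (h : IsACompact (c.u - d.u)) : IsACompact (c.v - d.v) := by
  have hd : IsACompact (d.u.comp d.v - ContinuousLinearMap.id Aᵐᵒᵖ M₁) := d.swap.isACompact_v_u
  convert! ((c.isACompact_v_u.comp_right d.v).sub (hd.comp_left c.v)).sub
    ((h.comp_left c.v).comp_right d.v) using 1
  ext x
  simp
  abel

theorem isACompact_cross (c : Corner F M₀ M₁) (d : Corner G M₀ M₁)
    (h : IsACompact (c.u - d.u)) :
    IsACompact ((c.v.comp d.u - ContinuousLinearMap.id Aᵐᵒᵖ M₀) +
      (d.v.comp c.u - ContinuousLinearMap.id Aᵐᵒᵖ M₀)) := by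
  convert! (c.isACompact_v_u.sub (h.comp_left c.v)).add
    (d.isACompact_v_u.add (h.comp_left d.v)) using 1
  ext x
  simp

/-- The submodules `F.E₀` at `0`, `G.E₀` at `1` and `M₀` in between. -/
def family (c : Corner F M₀ M₁) (d : Corner G M₀ M₁) (t : unitInterval) : Submodule Aᵐᵒᵖ M₀ :=
  open Classical in if t = 0 then c.range₀ else if t = 1 then d.range₀ else ⊤

theorem mem_family (c : Corner F M₀ M₁) (d : Corner G M₀ M₁) {t : unitInterval} {x : M₀} :
    x ∈ c.family d t ↔ (t = 0 → x ∈ c.range₀) ∧ (t = 1 → x ∈ d.range₀) := by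
  unfold family
  by_cases h0 : t = 0
  · simp [h0]
  · by_cases h1 : t = 1 <;> simp [h0, h1]

theorem isClosed_family (c : Corner F M₀ M₁) (d : Corner G M₀ M₁) (t : unitInterval) :
    IsClosed (c.family d t : Set M₀) := by
  unfold family
  split_ifs
  · exact c.isClosed_range₀
  · exact d.isClosed_range₀
  · exact isClosed_univ

end Corner

/-- The function `t ↦ t`. -/
def rampUp : C(unitInterval, ℂ) := ⟨fun t => ((t : ℝ) : ℂ), by fun_prop⟩

/-- The function `t ↦ 1 - t`. -/
def rampDown : C(unitInterval, ℂ) := 1 - rampUp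

theorem rampUp_zero : rampUp 0 = 0 := by simp [rampUp]
theorem rampUp_one : rampUp 1 = 1 := by simp [rampUp]
theorem rampDown_zero : rampDown 0 = 1 := by simp [rampDown, rampUp]
theorem rampDown_one : rampDown 1 = 0 := by simp [rampDown, rampUp]

namespace Corner

variable {F G : FredholmModule A} {M₀ M₁ : BanachModule A}

/-- A cutoff that vanishes at one end makes the constraint there automatic, which lets operators
that respect only one of the two summands act on the path module. -/
theorem smul_mem_family_left (c : Corner F M₀ M₁) (d : Corner G M₀ M₁) {a : C(unitInterval, ℂ)}
    (ha : a 1 = 0) {t : unitInterval} {x : M₀} (h : t = 0 → x ∈ c.range₀) :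
    a t • x ∈ c.family d t := by
  rw [mem_family]
  refine ⟨fun h0 => Submodule.smul_of_tower_mem _ _ (h h0), fun h1 => ?_⟩
  rw [h1, ha, zero_smul]
  exact Submodule.zero_mem _

theorem smul_mem_family_right (c : Corner F M₀ M₁) (d : Corner G M₀ M₁) {a : C(unitInterval, ℂ)}
    (ha : a 0 = 0) {t : unitInterval} {x : M₀} (h : t = 1 → x ∈ d.range₀) :
    a t • x ∈ c.family d t := by
  rw [mem_family]
  refine ⟨fun h0 => ?_, fun h1 => Submodule.smul_of_tower_mem _ _ (h h1)⟩
  rw [h0, ha, zero_smul]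
  exact Submodule.zero_mem _

/-- The linear path from `c.u` to `d.u`. -/
def pathMorphism (c : Corner F M₀ M₁) (d : Corner G M₀ M₁) :
    PathModule (c.family d) →L[C(unitInterval, A)ᵐᵒᵖ] PathModule (c.swap.family d.swap) :=
  pathMap rampDown c.u (fun _ _ hx => smul_mem_family_left _ _ rampDown_one
      fun h0 => c.u_mem ((c.mem_family d).1 hx |>.1 h0)) +
    pathMap rampUp d.u (fun _ _ hx => smul_mem_family_right _ _ rampUp_zero
      fun h1 => d.u_mem ((c.mem_family d).1 hx |>.2 h1))

theorem pathMorphism_apply (c : Corner F M₀ M₁) (d : Corner G M₀ M₁)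
    (f : PathModule (c.family d)) (t : unitInterval) :
    (c.pathMorphism d f).1 t = rampDown t • c.u (f.1 t) + rampUp t • d.u (f.1 t) := rfl

/-- With `b = 1 - a` one has `b² + a² + 2ab = 1`, so the composite minus `1` is `b²(vu - 1) +
a²(v'u' - 1) + ab((vu' - 1) + (v'u - 1))`. The first term lies in the summand `F`, the second in
`G`, and the mixed one vanishes at both ends, so each is a compact operator of the path module. -/
theorem isACompact_pathMorphism (c : Corner F M₀ M₁) (d : Corner G M₀ M₁)
    (h : IsACompact (c.u - d.u)) :
    IsACompact ((show PathModule (c.swap.family d.swap) →L[C(unitInterval, A)ᵐᵒᵖ]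
        PathModule (c.family d) from c.swap.pathMorphism d.swap).comp (c.pathMorphism d) -
      ContinuousLinearMap.id C(unitInterval, A)ᵐᵒᵖ (PathModule (c.family d))) := by
  have h0 := isACompact_pathMap (N := c.family d) (N' := c.family d) (rampDown * rampDown)
    (F.compact₀.comp_right c.ρ₀) c.ι₀ fun t y => smul_mem_family_left _ _
      (by simp [rampDown_one]) fun _ => c.ι₀_mem y
  have h1 := isACompact_pathMap (N := c.family d) (N' := c.family d) (rampUp * rampUp)
    (G.compact₀.comp_right d.ρ₀) d.ι₀ fun t y => smul_mem_family_right _ _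
      (by simp [rampUp_zero]) fun _ => d.ι₀_mem y
  have h2 := isACompact_pathMap (N := c.family d) (N' := c.family d) (rampDown * rampUp)
    (c.isACompact_cross d h) (ContinuousLinearMap.id Aᵐᵒᵖ M₀) fun t y => by
      rw [mem_family]
      constructor <;> rintro rfl
      · simp [rampUp_zero]
      · simp [rampDown_one]
  convert! (h0.add h1).add h2 using 1
  refine ContinuousLinearMap.ext fun f => PathModule.ext fun t => ?_
  have hc := c.v_u (f.1 t)
  have hd := d.v_u (f.1 t)
  set x := f.1 t with hx
  set a := rampUp t with ha
  have hb : rampDown t = 1 - a := rfl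
  change rampDown t • c.v (rampDown t • c.u x + rampUp t • d.u x) +
    rampUp t • d.v (rampDown t • c.u x + rampUp t • d.u x) - x =
    (rampDown t * rampDown t) • c.ι₀ (F.v (F.u (c.ρ₀ x)) - c.ρ₀ x) +
    (rampUp t * rampUp t) • d.ι₀ (G.v (G.u (d.ρ₀ x)) - d.ρ₀ x) +
    (rampDown t * rampUp t) • ((c.v (d.u x) - x) + (d.v (c.u x) - x))
  rw [← hc, ← hd, hb, ← ha]
  have hlin : ∀ (k : M₁ →L[Aᵐᵒᵖ] M₀) (z : ℂ) (y : M₁), k (z • y) = z • k y := fun k z y =>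
    map_smul (k.restrictScalars ℂ) z y
  simp only [map_add, hlin]
  module

variable [CompleteSpace A]

/-- The value at `s` lies in the summand `F.E₀`, where `c.u` restricts to `F.u`; elementary tensors
suffice. Through `swap` this also treats `v`. -/
theorem fibreMap_cmap {s : unitInterval} (c : Corner F M₀ M₁)
    {N : unitInterval → Submodule Aᵐᵒᵖ M₀} {N' : unitInterval → Submodule Aᵐᵒᵖ M₁}
    (U : PathModule N →L[C(unitInterval, A)ᵐᵒᵖ] PathModule N')
    (hU : ∀ f, (U f).1 s = c.u (f.1 s)) (hN : ∀ x ∈ N s, c.ι₀ (c.ρ₀ x) = x)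
    (z : CompletedTensor (evalHom A s) (PathModule N)) :
    fibreMap N' s c.ρ₁ (cmap (evalHom A s) U z) = F.u (fibreMap N s c.ρ₀ z) := by
  refine DFunLike.congr_fun (f := (fibreMap N' s c.ρ₁).comp (cmap (evalHom A s) U))
    (g := F.u.comp (fibreMap N s c.ρ₀)) (CompletedTensor.hom_ext _ fun f b => ?_) z
  change fibreMap N' s c.ρ₁ (cmap (evalHom A s) U (ctmul (evalHom A s) f b)) =
    F.u (fibreMap N s c.ρ₀ (ctmul (evalHom A s) f b))
  rw [cmap_ctmul, fibreMap_ctmul, map_smul]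
  refine (fibreMap_ctmul s c.ρ₁ (U f) b).trans ?_
  rw [hU]
  conv_lhs => rw [← hN _ (f.2 s), c.u_ι₀, c.ρ₁_ι₁]

/-- The fibre at `0`. -/
def fibreZero (c : Corner F M₀ M₁) (d : Corner G M₀ M₁) :
    CompletedTensor (evalHom A 0) (PathModule (c.family d)) ≃L[Aᵐᵒᵖ] F.E₀ :=
  fibreEquiv 0 c.ι₀ c.ρ₀ c.ρ₀_ι₀ (fun _ hx => c.mem_range₀.1 (((c.mem_family d).1 hx).1 rfl))
    rampDown rampDown_zero fun _ y => smul_mem_family_left _ _ rampDown_one fun _ => c.ι₀_mem y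

/-- The fibre at `1`. -/
def fibreOne (c : Corner F M₀ M₁) (d : Corner G M₀ M₁) :
    CompletedTensor (evalHom A 1) (PathModule (c.family d)) ≃L[Aᵐᵒᵖ] G.E₀ :=
  fibreEquiv 1 d.ι₀ d.ρ₀ d.ρ₀_ι₀ (fun _ hx => d.mem_range₀.1 (((c.mem_family d).1 hx).2 rfl))
    rampUp rampUp_one fun _ y => smul_mem_family_right _ _ rampUp_zero fun _ => d.ι₀_mem y

theorem fibreZero_cmap (c : Corner F M₀ M₁) (d : Corner G M₀ M₁)
    (z : CompletedTensor (evalHom A 0) (PathModule (c.family d))) :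
    c.swap.fibreZero d.swap (cmap (evalHom A 0) (c.pathMorphism d) z) =
      F.u (c.fibreZero d z) :=
  c.fibreMap_cmap (c.pathMorphism d)
    (fun f => by rw [pathMorphism_apply, rampDown_zero, rampUp_zero, one_smul, zero_smul, add_zero])
    (fun _ hx => c.mem_range₀.1 (((c.mem_family d).1 hx).1 rfl)) z

theorem fibreOne_cmap (c : Corner F M₀ M₁) (d : Corner G M₀ M₁)
    (z : CompletedTensor (evalHom A 1) (PathModule (c.family d))) :
    c.swap.fibreOne d.swap (cmap (evalHom A 1) (c.pathMorphism d) z) =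
      G.u (c.fibreOne d z) :=
  d.fibreMap_cmap (c.pathMorphism d)
    (fun f => by rw [pathMorphism_apply, rampDown_one, rampUp_one, one_smul, zero_smul, zero_add])
    (fun _ hx => d.mem_range₀.1 (((c.mem_family d).1 hx).2 rfl)) z

theorem homotopic (c : Corner F M₀ M₁) (d : Corner G M₀ M₁) (h : IsACompact (c.u - d.u)) :
    F.Homotopic G := by
  have h0 := completeSpace_pathModule (c.isClosed_family d)
  have h1 := completeSpace_pathModule (c.swap.isClosed_family d.swap)
  exact ⟨⟨⟨PathModule (c.family d)⟩, ⟨PathModule (c.swap.family d.swap)⟩, c.pathMorphism d,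
    c.swap.pathMorphism d.swap, c.isACompact_pathMorphism d h,
    c.swap.isACompact_pathMorphism d.swap (c.isACompact_v_sub d h)⟩,
    ⟨c.fibreZero d, c.swap.fibreZero d.swap, c.fibreZero_cmap d, c.swap.fibreZero_cmap d.swap⟩,
    ⟨c.fibreOne d, c.swap.fibreOne d.swap, c.fibreOne_cmap d, c.swap.fibreOne_cmap d.swap⟩⟩

end Corner

variable [CompleteSpace A] {F G : FredholmModule A}

theorem StablyEquiv.homotopic (h : F.StablyEquiv G) : F.Homotopic G := by
  obtain ⟨X, Y, e₀, e₁, h⟩ := h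
  -- `G` becomes a second corner of the modules `F.E₀ ⊕ X`, `F.E₁ ⊕ X`, and the two `u` differ by
  -- `e₁⁻¹` applied to the compact defect.
  refine (Corner.stabilize F X).homotopic ((Corner.stabilize G Y).transport (N₀ := ⟨F.E₀ × X⟩)
    (N₁ := ⟨F.E₁ × X⟩) e₀ e₁) ?_
  convert! h.comp_left e₁.symm.toContinuousLinearMap using 1
  refine ContinuousLinearMap.ext fun x => ?_
  change F.u.prodMap (ContinuousLinearMap.id Aᵐᵒᵖ X) x -
    e₁.symm (G.u.prodMap (ContinuousLinearMap.id Aᵐᵒᵖ Y) (e₀ x)) =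
    e₁.symm (e₁ (F.u.prodMap (ContinuousLinearMap.id Aᵐᵒᵖ X) x) -
      G.u.prodMap (ContinuousLinearMap.id Aᵐᵒᵖ Y) (e₀ x))
  rw [map_sub, e₁.symm_apply_apply]

/-- Fredholm modules are homotopic if and only if they have the same index. -/
theorem homotopic_iff : F.Homotopic G ↔ F.index = G.index :=
  ⟨Homotopic.index_eq, fun h => (stablyEquiv_of_index_eq h).homotopic⟩

theorem exists_index_eq (z : K0 A) : ∃ F : FredholmModule A, F.index = z := by
  obtain ⟨P, Q, rfl⟩ := K0.exists_eq_sub z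
  obtain ⟨E, hE, ⟨e⟩⟩ := exists_banachModule P
  obtain ⟨E', hE', ⟨e'⟩⟩ := exists_banachModule Q
  have := finite_of_isACompact_id hE
  have := projective_of_isACompact_id hE
  have := finite_of_isACompact_id hE'
  have := projective_of_isACompact_id hE'
  exact ⟨ofZero E E' hE hE', by rw [index_ofZero, K0.cls_congr e, K0.cls_congr e']⟩

end FredholmModule

/-- The index on homotopy classes. -/
def FredholmClass.index (A : Type u) [NormedRing A] [NormedAlgebra ℂ A] [CompleteSpace A] :
    FredholmClass A → K0 A :=
  Quot.lift FredholmModule.index fun _ _ => FredholmModule.Homotopic.index_eq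

end

end BanachKTheory

/-! ### The main theorem -/

theorem mainTheorem11 :
    -- homotopy is an equivalence relation
    (∀ (A : Type u) [NormedRing A] [NormedAlgebra ℂ A] [CompleteSpace A],
      Equivalence (BanachKTheory.FredholmModule.Homotopic (A := A))) ∧
    -- homotopy classes are functorial for unital morphisms of Banach algebras
    (∀ (A B : Type u) [NormedRing A] [NormedAlgebra ℂ A] [CompleteSpace A]
      [NormedRing B] [NormedAlgebra ℂ B] [CompleteSpace B]
      (θ : BanachKTheory.BanachAlgHom A B) (F G : BanachKTheory.FredholmModule A),
      F.Homotopic G → (F.baseChange θ).Homotopic (G.baseChange θ)) ∧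
    (∀ (A : Type u) [NormedRing A] [NormedAlgebra ℂ A] [CompleteSpace A]
      (F : BanachKTheory.FredholmModule A),
      (F.baseChange (BanachKTheory.BanachAlgHom.id A)).Homotopic F) ∧
    (∀ (A B C : Type u) [NormedRing A] [NormedAlgebra ℂ A] [CompleteSpace A]
      [NormedRing B] [NormedAlgebra ℂ B] [CompleteSpace B]
      [NormedRing C] [NormedAlgebra ℂ C] [CompleteSpace C]
      (θ : BanachKTheory.BanachAlgHom A B) (φ : BanachKTheory.BanachAlgHom B C)
      (F : BanachKTheory.FredholmModule A),
      (F.baseChange (φ.comp θ)).Homotopic ((F.baseChange θ).baseChange φ)) ∧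
    -- the index is a natural bijection from homotopy classes to `K_0`
    ∃ ind : ∀ (A : Type u) [NormedRing A] [NormedAlgebra ℂ A] [CompleteSpace A],
        BanachKTheory.FredholmClass A → BanachKTheory.K0 A,
      (∀ (A : Type u) [NormedRing A] [NormedAlgebra ℂ A] [CompleteSpace A]
        (F : BanachKTheory.FredholmModule A),
        Nonempty F.Stabilization ∧
        ∀ s : F.Stabilization,
          ∃ (_ : Module.Finite Aᵐᵒᵖ s.kernel) (_ : Module.Projective Aᵐᵒᵖ s.kernel),
            ind A (BanachKTheory.FredholmClass.mk F) =
              BanachKTheory.K0.cls A s.kernel - BanachKTheory.K0.cls A (Fin s.n → A)) ∧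
      (∀ (A : Type u) [NormedRing A] [NormedAlgebra ℂ A] [CompleteSpace A],
        Function.Bijective (ind A)) ∧
      (∀ (A B : Type u) [NormedRing A] [NormedAlgebra ℂ A] [CompleteSpace A]
        [NormedRing B] [NormedAlgebra ℂ B] [CompleteSpace B]
        (θ : BanachKTheory.BanachAlgHom A B) (F : BanachKTheory.FredholmModule A),
        ind B (BanachKTheory.FredholmClass.mk (F.baseChange θ)) =
          BanachKTheory.K0.map θ.ringHom (ind A (BanachKTheory.FredholmClass.mk F))) := by
  open BanachKTheory FredholmModule in
  refine ⟨?_, ?_, ?_, ?_, FredholmClass.index, ?_, ?_, ?_⟩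
  · intro A _ _ _
    -- Transitivity comes from equality of indices; no gluing of homotopies takes place.
    exact ⟨fun F => homotopic_iff.2 rfl, fun h => homotopic_iff.2 (homotopic_iff.1 h).symm,
      fun h h' => homotopic_iff.2 ((homotopic_iff.1 h).trans (homotopic_iff.1 h'))⟩
  · intro A B _ _ _ _ _ _ θ F G h
    rw [homotopic_iff, index_baseChange, index_baseChange, homotopic_iff.1 h]
  · intro A _ _ _ F
    rw [homotopic_iff, index_baseChange]
    exact DFunLike.congr_fun K0.map_id F.index
  · intro A B C _ _ _ _ _ _ _ _ _ θ φ F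
    -- The two completed tensor products are never compared: their indices agree by functoriality of
    -- `K_0`.
    rw [homotopic_iff, index_baseChange, index_baseChange, index_baseChange]
    exact DFunLike.congr_fun (K0.map_comp θ.ringHom φ.ringHom) F.index
  · intro A _ _ _ F
    exact ⟨F.nonempty_stabilization, fun s => ⟨inferInstance, inferInstance, index_eq s⟩⟩
  · intro A _ _ _
    refine ⟨?_, fun z => ?_⟩
    · rintro ⟨F⟩ ⟨G⟩ h
      exact Quot.sound (homotopic_iff.2 h)
    · obtain ⟨F, hF⟩ := exists_index_eq z
      exact ⟨FredholmClass.mk F, hF⟩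
  · intro A B _ _ _ _ _ _ θ F
    exact index_baseChange θ F
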